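/- Let $\Gamma$ be a finite undirected graph (multiple edges and loops are allowed) with vertex set $V$ and edge set $E$, and let $\mu : V \to (0,\infty)$ be a weighting. Let $\vec\Gamma$ be its directed version: a non-loop edge with ends $\alpha\ne\beta$ gives two directed edges $\epsilon,\epsilon^{op}$ with $s(\epsilon)=t(\epsilon^{op})=\alpha$ and $t(\epsilon)=s(\epsilon^{op})=\beta$, and a loop gives one directed loop $\epsilon=\epsilon^{op}$. Let $\mathcal H$ be the Hilbert space with orthogonal basis the finite directed paths in $\vec\Gamma$ (paths of length $0$ are the vertices), where a path ending at $\beta$ has norm $\sqrt{\mu(\beta)}$. Let $p_\beta$ be the projection onto the span of the paths starting at $\beta$, let $\ell(\epsilon)$ be the creation operator that prepends $\epsilon$ to a path (and gives $0$ if the result is not a path), put $a_\epsilon=(\mu(s(\epsilon))/\mu(t(\epsilon)))^{1/4}$ and $$X_\epsilon = a_\epsilon\,\ell(\epsilon)+a_\epsilon^{-1}\,\ell(\epsilon^{op})^{*}.$$ For an undirected edge $e$ let $X_e=X_\epsilon$ if $e$ is a loop with directed loop $\epsilon$, and $X_e=X_\epsilon+X_{\epsilon^{op}}$ otherwise. Let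 $\mathcal A$ be the algebra generated by all $p_\beta$ and $X_\epsilon$ (the polynomials in the $p_\beta$ and $X_\epsilon$), $\mathcal S(\Gamma,\mu)$ the C$^*$-algebra generated by all $p_\beta$ and $X_e$, and $\mathcal M(\Gamma,\mu)=\mathcal S(\Gamma,\mu)''$ the von Neumann algebra it generates on $\mathcal H$. Let $\mathrm{Tr}(x)=\sum_{\beta\in V}\langle \beta , x\,\beta\rangle$, where $\beta\in V$ is regarded as a path of length $0$. Let $\alpha\in V$ satisfy $\mu(\alpha)=\min_{\beta\in V}\mu(\beta)$. 1. Let $Q\in\mathcal A$, $Q\neq 0$ and $Qp_\alpha=Q$. If $a=a^*=p_\alpha a p_\alpha\in\mathcal M(\Gamma,\mu)$ and $Qa=0$, then $a=0$. 2. Let $Q=Q^*\in\mathcal A$ with $Q=Qp_\alpha$ $(=p_\alpha Qp_\alpha)$, and suppose that $Q$ is not a scalar multiple of $p_\alpha$. Then $Q$ has a unique law in $(p_\alpha\mathcal S(\Gamma,\mu)p_\alpha,\mathrm{Tr})$, i.e. there is exactly one finite compactly supported Borel measure $\nu$ on $\mathbb R$ with $\int x^n\,d\nu(x)=\mathrm{Tr}(Q^n)$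 for all $n\ge 0$ (where $Q^0=p_\alpha$), and this law has no atoms: $\nu(\{x\})=0$ for every $x\in\mathbb R$. -/

import Mathlib

namespace FreeGraph

noncomputable section

universe u v

open scoped Classical Graph lp

/-- An edge of the directed version of the undirected multigraph `G`: an edge of `G` together with
an ordering of its two ends. A non-loop of `G` gives two directed edges, a loop gives one. -/
@[ext]
structure DEdge {V : Type u} {E : Type v} (G : Graph V E) where
  edge : E
  src : V(G)
  tgt : V(G)
  isLink : G.IsLink edge src tgt

/-- The opposite directed edge; a loop is its own opposite. -/
def DEdge.op {V : Type u} {E : Type v} {G : Graph V E} (ε : DEdge G) : DEdge G where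
  edge := ε.edge
  src := ε.tgt
  tgt := ε.src
  isLink := ε.isLink.symm

/-- The list of directed edges is a path that starts at the given vertex. -/
def IsPathFrom {V : Type u} {E : Type v} {G : Graph V E} : V(G) → List (DEdge G) → Prop
  | _, [] => True
  | x, ε :: l => ε.src = x ∧ IsPathFrom ε.tgt l

/-- Directed paths of finite length in `G`. A path of length `0` is a vertex. -/
@[ext]
structure DPath {V : Type u} {E : Type v} (G : Graph V E) where
  start : V(G)
  edges : List (DEdge G)
  isPath : IsPathFrom start edges

/-- The path of length `0` at a vertex. -/
def DPath.nil {V : Type u} {E : Type v} {G : Graph V E} (x : V(G)) : DPath G :=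
  ⟨x, [], trivial⟩

/-- The path `ε ε₁ ⋯ εₙ`, where `ε₁ ⋯ εₙ` starts at the target of `ε`. -/
def DPath.cons {V : Type u} {E : Type v} {G : Graph V E} (ε : DEdge G) (p : DPath G)
    (h : ε.tgt = p.start) : DPath G :=
  ⟨ε.src, ε :: p.edges, rfl, h ▸ p.isPath⟩

/-- The partial bijection `p ↦ ε p` of paths, defined on the paths that start at the target
of `ε`. Its inverse removes a first edge that is equal to `ε`. -/
def consPEquiv {V : Type u} {E : Type v} {G : Graph V E} (ε : DEdge G) : DPath G ≃. DPath G where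
  toFun p := if h : ε.tgt = p.start then some (DPath.cons ε p h) else none
  invFun q := match q with
    | ⟨_, [], _⟩ => none
    | ⟨_, ε' :: l, h⟩ => if e : ε' = ε then some ⟨ε.tgt, l, e ▸ h.2⟩ else none
  inv := by
    rintro ⟨x, l, hl⟩ ⟨y, _ | ⟨ε', m⟩, hm⟩
    · simp [DPath.cons, DPath.ext_iff]
    · by_cases h : ε' = ε
      · subst h
        have h1 : ε'.src = y := hm.1
        by_cases h2 : ε'.tgt = x
        · simp [DPath.cons, DPath.ext_iff, h1, h2, eq_comm]
        · simp [DPath.ext_iff, h2]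
      · simp [DPath.cons, DPath.ext_iff, h, Ne.symm h]

/-- The bounded operator on `ℓ²(I)` that sends the basis vector `e_i` to `e_{φ i}` if `φ i` is
defined, and to `0` otherwise. -/
def shift {I : Type*} (φ : I ≃. I) : ℓ²(I, ℂ) →L[ℂ] ℓ²(I, ℂ) :=
  have key : ∀ (f : ℓ²(I, ℂ)) (s : Finset I),
      ∑ j ∈ s, ‖(φ.symm j).elim 0 f‖ ^ (2 : ENNReal).toReal ≤ ‖f‖ ^ (2 : ENNReal).toReal := by
    intro f s
    have h2 : 0 < (2 : ENNReal).toReal := by norm_num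
    refine le_trans ?_ (lp.sum_rpow_le_norm_rpow h2 f (s.biUnion fun j => (φ.symm j).toFinset))
    rw [Finset.sum_biUnion]
    · refine Finset.sum_le_sum fun j _ => ?_
      cases hj : φ.symm j <;> simp
    · intro j _ k _ hjk
      refine Finset.disjoint_left.2 fun i hi hi' => hjk ?_
      simp only [Option.mem_toFinset] at hi hi'
      exact φ.symm.inj hi hi'
  LinearMap.mkContinuous
    { toFun := fun f => ⟨fun j => (φ.symm j).elim 0 f, memℓp_gen' (key f)⟩
      map_add' := by
        intro f g
        refine Subtype.ext (funext fun j => ?_)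
        change (φ.symm j).elim (0 : ℂ) (fun i => f i + g i)
          = (φ.symm j).elim 0 (fun i => f i) + (φ.symm j).elim 0 (fun i => g i)
        cases φ.symm j <;> simp
      map_smul' := by
        intro c f
        refine Subtype.ext (funext fun j => ?_)
        change (φ.symm j).elim (0 : ℂ) (fun i => c * f i)
          = c * (φ.symm j).elim 0 (fun i => f i)
        cases φ.symm j <;> simp } 1
    (by
      intro f
      rw [one_mul]
      exact lp.norm_le_of_forall_sum_le (by norm_num) (norm_nonneg f) (key f))

theorem shift_apply {I : Type*} (φ : I ≃. I) (f : ℓ²(I, ℂ)) (j : I) :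
    shift φ f j = (φ.symm j).elim 0 f := rfl

/-- The Hilbert space `L²(S(Γ,μ), Tr)`, which is the full Fock space of the directed graph: it has
the finite directed paths as an orthogonal basis. The basis vectors are normalised here: for a path
`p` that ends at `x` the unit vector `lp.single 2 p 1` is `μ(x)^(-1/2)` times the path `p`.
As creation by an edge does not change the end of a path, the operators below are given by the
same formulas in either normalisation. -/
abbrev FockSpace {V : Type u} {E : Type v} (G : Graph V E) : Type (max u v) := ℓ²(DPath G, ℂ)

/-- The creation operator `ℓ(ε)`, which prepends `ε` to a path; its adjoint is the annihilation
operator. -/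
def creation {V : Type u} {E : Type v} {G : Graph V E} (ε : DEdge G) :
    FockSpace G →L[ℂ] FockSpace G :=
  shift (consPEquiv ε)

/-- The projection `p_x` onto the span of the paths that start at the vertex `x`. -/
def vertexProj {V : Type u} {E : Type v} {G : Graph V E} (x : V(G)) :
    FockSpace G →L[ℂ] FockSpace G :=
  shift (PEquiv.ofSet {p : DPath G | p.start = x})

/-- The number `a_ε = (μ(s(ε)) / μ(t(ε)))^(1/4)`. -/
def weightRatio {V : Type u} {E : Type v} {G : Graph V E} (μ : V(G) → ℝ) (ε : DEdge G) : ℝ :=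
  (μ ε.src / μ ε.tgt) ^ (1 / 4 : ℝ)

/-- `X_ε = a_ε ℓ(ε) + a_ε⁻¹ ℓ(ε^op)*`. For a loop this is `ℓ(ε) + ℓ(ε)*`. -/
def arcOp {V : Type u} {E : Type v} {G : Graph V E} (μ : V(G) → ℝ) (ε : DEdge G) :
    FockSpace G →L[ℂ] FockSpace G :=
  (weightRatio μ ε : ℂ) • creation ε
    + ((weightRatio μ ε)⁻¹ : ℂ) • ContinuousLinearMap.adjoint (creation ε.op)

/-- The self-adjoint generator `X_e` of the undirected edge `e` that underlies `ε`:
`ℓ(ε) + ℓ(ε)*` for a loop, and `X_ε + X_{ε^op}` otherwise. -/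
def edgeOp {V : Type u} {E : Type v} {G : Graph V E} (μ : V(G) → ℝ) (ε : DEdge G) :
    FockSpace G →L[ℂ] FockSpace G :=
  if ε.src = ε.tgt then creation ε + ContinuousLinearMap.adjoint (creation ε)
  else arcOp μ ε + arcOp μ ε.op

/-- The algebra `𝒜` of all polynomials in the `p_β` and the `X_ε`. -/
def polyAlgebra {V : Type u} {E : Type v} (G : Graph V E) (μ : V(G) → ℝ) :
    Subalgebra ℂ (FockSpace G →L[ℂ] FockSpace G) :=
  Algebra.adjoin ℂ (Set.range (vertexProj (G := G)) ∪ Set.range (arcOp μ))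

/-- The free graph algebra `S(Γ, μ)`: the C*-algebra generated by the `p_β` and the `X_e`
(the graph is finite wherever this is used, so that the algebra is unital). -/
def freeGraphAlgebra {V : Type u} {E : Type v} (G : Graph V E) (μ : V(G) → ℝ) :
    StarSubalgebra ℂ (FockSpace G →L[ℂ] FockSpace G) :=
  (StarAlgebra.adjoin ℂ
    (Set.range (vertexProj (G := G)) ∪ Set.range (edgeOp μ))).topologicalClosure

/-- The von Neumann algebra `M(Γ, μ)` generated by `S(Γ, μ)`, that is, its double commutant. -/
def vonNeumann {V : Type u} {E : Type v} (G : Graph V E) (μ : V(G) → ℝ) :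
    VonNeumannAlgebra (FockSpace G) where
  toStarSubalgebra := StarSubalgebra.centralizer ℂ
    (StarSubalgebra.centralizer ℂ (freeGraphAlgebra G μ : Set (FockSpace G →L[ℂ] FockSpace G)) :
      Set (FockSpace G →L[ℂ] FockSpace G))
  centralizer_centralizer' := by
    change Set.centralizer (Set.centralizer (Set.centralizer _)) = Set.centralizer _
    rw [Set.centralizer_centralizer_centralizer]

/-- The conditional expectation onto the functions on the vertices: the value of `E(x)` at `β` is
the coefficient of the vertex `β` in `x β`. -/
def condExpect {V : Type u} {E : Type v} {G : Graph V E} (x : FockSpace G →L[ℂ] FockSpace G)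
    (β : V(G)) : ℂ :=
  inner ℂ (lp.single 2 (DPath.nil β) (1 : ℂ) : FockSpace G) (x (lp.single 2 (DPath.nil β) 1))

/-- `Tr = tr ∘ E`, where `tr` is the trace on functions with `tr(p_β) = μ(β)`. -/
def Tr {V : Type u} {E : Type v} {G : Graph V E} [Fintype V(G)] (μ : V(G) → ℝ)
    (x : FockSpace G →L[ℂ] FockSpace G) : ℂ :=
  ∑ β : V(G), (μ β : ℂ) * condExpect x β

/-- `ν` is the law of `Q = p_α Q p_α` in `(p_α S(Γ, μ) p_α, Tr)`: the finite, compactly supported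
Borel measure whose `n`-th moment is the trace of the `n`-th power of `Q` for all `n`, where the
zeroth power is the unit `p_α` of the corner. -/
def IsLaw {V : Type u} {E : Type v} {G : Graph V E} [Fintype V(G)] (μ : V(G) → ℝ) (α : V(G))
    (Q : FockSpace G →L[ℂ] FockSpace G) (ν : MeasureTheory.Measure ℝ) : Prop :=
  MeasureTheory.IsFiniteMeasure ν ∧ (∃ R : ℝ, ν (Set.Icc (-R) R)ᶜ = 0) ∧
    ∀ n : ℕ, ((∫ x, x ^ n ∂ν : ℝ) : ℂ) = Tr μ (vertexProj α * Q ^ n)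

end

end FreeGraph

/-! Appending edges at the end of paths gives right operators `rightOp μ ε`, which commute with all
`p_β` and `X_ε`. Hence `vonNeumann G μ` lies in their commutant `rightCommutant μ`. There the vacuum
vectors `vac x` are separating (`eq_zero_of_vac`), and `Tr (T * S) = Tr (S * T)` as soon as `T` is a
polynomial (`Tr_mul_comm`). The whole argument runs in this commutant; its equality with the von
Neumann algebra is never needed.

The absence of zero divisors is an induction on degree (`eq_zero_of_polyOf_mul_eq_zero`). Let `T` be
a polynomial from the corner at `α` to the corner at `y`, with `T * a = 0` and `a ≠ 0`. Then `T` has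
a kernel in the corner at `α`. The trace turns this into a cokernel: since `μ α ≤ μ y`, the
projection `P` onto the kernel of `star T` does not vanish at `vac y` (`kerProj_star_vac_ne_zero`).
Now `P * T = 0` and `T * a = 0`, so for any operator `R` the product `P (T R - R T) a` vanishes. For
`R` the bare right annihilation by `ε`, the commutator with `X_δ` has rank one and is zero unless `δ
= ε`, so commutation with `R` behaves like a free difference quotient. Contracted with `P (vac y)`,
it yields a polynomial of smaller degree that still annihilates `a`
(`exists_contracted_commutator`). Its coefficient at `w₁` is a nonzero multiple of that of `T` at `ε
w₁`, so the descent ends at a nonzero multiple of `p_α`, which forces `a = 0`.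

For the law, `Tr` on the corner is a vector state. The measure exists by Riesz–Markov and is unique
by Weierstrass approximation. An atom at `x` makes the kernel projection of `Q - x` nonzero at `vac
α`; cut down by `p_α` it is annihilated by the nonzero polynomial `Q - x p_α`, a contradiction. -/

namespace FreeGraph

noncomputable section

universe u v

open scoped Classical Graph lp InnerProductSpace

open ContinuousLinearMap (adjoint)

variable {V : Type u} {E : Type v} {G : Graph V E}

/-! ### Shift operators -/

section Shift

variable {I : Type*}

/-- The standard basis vector of `ℓ²(I)`. -/
def ket (i : I) : ℓ²(I, ℂ) := lp.single 2 i 1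

theorem inner_ket (i : I) (f : ℓ²(I, ℂ)) : inner ℂ (ket i) f = f i := by
  simp [ket, lp.inner_single_left]

theorem norm_ket (i : I) : ‖ket i‖ = 1 := by
  rw [ket, lp.norm_single (by norm_num)]; simp

theorem ket_apply (i j : I) : ket i j = if j = i then 1 else 0 := by
  simp [ket, lp.single_apply, Pi.single_apply]

theorem inner_ket_ket (i j : I) : inner ℂ (ket i) (ket j) = if i = j then (1 : ℂ) else 0 := by
  rw [inner_ket, ket_apply]

theorem ext_inner_ket {f g : ℓ²(I, ℂ)} (h : ∀ i, inner ℂ (ket i) f = inner ℂ (ket i) g) :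
    f = g := by
  refine Subtype.ext (funext fun i => ?_)
  simpa only [inner_ket] using h i

theorem shift_ket (φ : I ≃. I) (i : I) : shift φ (ket i) = (φ i).elim 0 ket := by
  refine Subtype.ext (funext fun j => ?_)
  rw [shift_apply]
  rcases hj : φ.symm j with _ | k
  · rcases hi : φ i with _ | m
    · rfl
    · have : j ≠ m := by
        rintro rfl
        rw [(φ.eq_some_iff).2 hi] at hj
        cases hj
      simp [ket_apply, this]
  · have hk : φ k = some j := (φ.eq_some_iff).1 hj
    by_cases h : k = i
    · subst h; simp [hk, ket_apply]
    · rcases hi : φ i with _ | m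
      · simp [ket_apply, h]
      · have : j ≠ m := by
          rintro rfl
          exact h (φ.inj hk hi)
        simp [ket_apply, h, this]

theorem inner_ket_shift (φ : I ≃. I) (i : I) (f : ℓ²(I, ℂ)) :
    inner ℂ (ket i) (shift φ f) = inner ℂ (shift φ.symm (ket i)) f := by
  rw [inner_ket, shift_apply, shift_ket]
  cases φ.symm i <;> simp [inner_ket]

/-- Passing to adjoints turns the hypothesis into an equality of coordinates, so no density argument
for the span of the basis is needed. -/
theorem ket_ext {A B : ℓ²(I, ℂ) →L[ℂ] ℓ²(I, ℂ)} (h : ∀ i, A (ket i) = B (ket i)) : A = B := by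
  have key : adjoint A = adjoint B := by
    ext1 f
    refine ext_inner_ket fun i => ?_
    rw [ContinuousLinearMap.adjoint_inner_right, ContinuousLinearMap.adjoint_inner_right, h]
  simpa using congrArg adjoint key

theorem adjoint_shift (φ : I ≃. I) : adjoint (shift φ) = shift φ.symm := by
  ext1 f
  refine ext_inner_ket fun i => ?_
  rw [ContinuousLinearMap.adjoint_inner_right, inner_ket_shift, PEquiv.symm_symm]

end Shift

/-! ### Paths -/

theorem DEdge.op_op (ε : DEdge G) : ε.op.op = ε := rfl

theorem DEdge.op_eq_self {ε : DEdge G} (h : ε.src = ε.tgt) : ε.op = ε := by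
  ext1
  · rfl
  · exact h.symm
  · exact h

theorem DPath.induction_cons {P : DPath G → Prop} (p : DPath G) (nil : ∀ x, P (DPath.nil x))
    (cons : ∀ ε p h, P p → P (DPath.cons ε p h)) : P p := by
  obtain ⟨x, l, hl⟩ := p
  induction l generalizing x with
  | nil => exact nil x
  | cons ε l ih =>
    obtain ⟨rfl, h⟩ := hl
    exact cons ε ⟨ε.tgt, l, h⟩ rfl (ih _ h)

/-- The vertex at which a list of edges ends that starts at the given vertex. -/
def endFrom : V(G) → List (DEdge G) → V(G)
  | x, [] => x
  | _, ε :: l => endFrom ε.tgt l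

/-- The end of a path. -/
def DPath.finish (p : DPath G) : V(G) := endFrom p.start p.edges

/-- The number of edges of a path. -/
def DPath.length (p : DPath G) : ℕ := p.edges.length

@[simp] theorem DPath.start_nil (x : V(G)) : (DPath.nil x).start = x := rfl
@[simp] theorem DPath.finish_nil (x : V(G)) : (DPath.nil x).finish = x := rfl
@[simp] theorem DPath.length_nil (x : V(G)) : (DPath.nil x).length = 0 := rfl
@[simp] theorem DPath.start_cons (ε : DEdge G) (p : DPath G) (h) :
    (DPath.cons ε p h).start = ε.src := rfl
@[simp] theorem DPath.length_cons (ε : DEdge G) (p : DPath G) (h) :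
    (DPath.cons ε p h).length = p.length + 1 := rfl
@[simp] theorem DPath.finish_cons (ε : DEdge G) (p : DPath G) (h) :
    (DPath.cons ε p h).finish = p.finish := by
  simp only [DPath.finish, DPath.cons, endFrom, h]

theorem DPath.cons_inj {ε δ : DEdge G} {p q : DPath G} {h h'} :
    DPath.cons ε p h = DPath.cons δ q h' ↔ ε = δ ∧ p = q := by
  constructor
  · intro e
    have e1 := congrArg DPath.edges e
    simp only [DPath.cons, List.cons.injEq] at e1
    refine ⟨e1.1, DPath.ext ?_ e1.2⟩
    rw [← h, ← h', e1.1]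
  · rintro ⟨rfl, rfl⟩; rfl

theorem DPath.cons_ne_nil {ε : DEdge G} {p : DPath G} {h} {x : V(G)} :
    DPath.cons ε p h ≠ DPath.nil x := by
  intro e
  simpa using congrArg DPath.length e

theorem isPathFrom_append (ε : DEdge G) (x : V(G)) (l : List (DEdge G)) :
    IsPathFrom x l → endFrom x l = ε.src → IsPathFrom x (l ++ [ε]) := by
  induction l generalizing x with
  | nil => exact fun _ h => ⟨h.symm, trivial⟩
  | cons δ l ih => exact fun h h' => ⟨h.1, ih _ h.2 h'⟩

/-- The path `p ε`, where `p` ends at the source of `ε`. -/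
def DPath.snoc (p : DPath G) (ε : DEdge G) (h : p.finish = ε.src) : DPath G :=
  ⟨p.start, p.edges ++ [ε], isPathFrom_append ε p.start p.edges p.isPath h⟩

@[simp] theorem DPath.start_snoc (p : DPath G) (ε : DEdge G) (h) :
    (p.snoc ε h).start = p.start := rfl
@[simp] theorem DPath.length_snoc (p : DPath G) (ε : DEdge G) (h) :
    (p.snoc ε h).length = p.length + 1 := by
  simp [DPath.length, DPath.snoc]

theorem DPath.snoc_cons (ε δ : DEdge G) (p : DPath G) (h : δ.tgt = p.start) (h') :
    (DPath.cons δ p h).snoc ε h' =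
      DPath.cons δ (p.snoc ε ((DPath.finish_cons δ p h).symm.trans h'))
        (h.trans (DPath.start_snoc p ε _).symm) := rfl

theorem DPath.snoc_nil (ε : DEdge G) (x : V(G)) (h : (DPath.nil x).finish = ε.src) :
    (DPath.nil x).snoc ε h = DPath.cons ε (DPath.nil ε.tgt) (DPath.start_nil ε.tgt).symm := by
  obtain rfl : x = ε.src := h
  rfl

theorem DPath.snoc_inj {ε : DEdge G} {p q : DPath G} {h h'}
    (e : p.snoc ε h = q.snoc ε h') : p = q := by
  have e1 := congrArg DPath.edges e
  have e2 := congrArg DPath.start e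
  exact DPath.ext e2 (List.append_cancel_right e1)

theorem DPath.exists_snoc (p : DPath G) (hp : p.length ≠ 0) :
    ∃ q ε h, p = DPath.snoc q ε h := by
  induction p using DPath.induction_cons with
  | nil x => exact absurd rfl hp
  | cons δ p h ih =>
    by_cases h0 : p.length = 0
    · induction p using DPath.induction_cons with
      | nil x =>
        refine ⟨DPath.nil δ.src, δ, DPath.finish_nil _, ?_⟩
        rw [DPath.snoc_nil, DPath.cons_inj]
        exact ⟨rfl, by rw [h]; rfl⟩
      | cons => simp at h0
    · obtain ⟨q, ε, hq, rfl⟩ := ih h0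
      exact ⟨DPath.cons δ q h, ε, (DPath.finish_cons δ q h).trans hq, rfl⟩

/-- The partial bijection `p ↦ p ε` of paths, defined on the paths that end at the source
of `ε`. -/
def snocPEquiv (ε : DEdge G) : DPath G ≃. DPath G where
  toFun p := if h : p.finish = ε.src then some (p.snoc ε h) else none
  invFun q := if h : ∃ p, ∃ h : p.finish = ε.src, p.snoc ε h = q then some h.choose else none
  inv := by
    intro p q
    constructor
    · intro h
      split_ifs at h with h1
      · obtain ⟨h2, h3⟩ := h1.choose_spec
        simp only [Option.some.injEq] at h
        subst h
        simp [h2, h3]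
    · intro h
      split_ifs at h with h1
      · simp only [Option.some.injEq] at h
        have h2 : ∃ p : DPath G, ∃ h : p.finish = ε.src, p.snoc ε h = q := ⟨p, h1, h⟩
        rw [dif_pos h2]
        refine congrArg some ?_
        obtain ⟨h3, h4⟩ := h2.choose_spec
        exact DPath.snoc_inj (h4.trans h.symm)

/-- The right creation operator, which appends `ε` to a path. -/
def rightCreation (ε : DEdge G) : FockSpace G →L[ℂ] FockSpace G := shift (snocPEquiv ε)

/-- The path of length `0` at `x` as a vector. -/
def vac (x : V(G)) : FockSpace G := ket (DPath.nil x)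

theorem vertexProj_ket (x : V(G)) (p : DPath G) :
    vertexProj x (ket p) = if p.start = x then ket p else 0 := by
  rw [vertexProj, shift_ket]
  by_cases h : p.start = x <;> simp [PEquiv.ofSet, h]

theorem adjoint_vertexProj (x : V(G)) : adjoint (vertexProj (G := G) x) = vertexProj x := by
  rw [vertexProj, adjoint_shift, PEquiv.ofSet_symm]

theorem creation_ket (ε : DEdge G) (p : DPath G) :
    creation ε (ket p) = if h : ε.tgt = p.start then ket (DPath.cons ε p h) else 0 := by
  rw [creation, shift_ket]
  change (if h : ε.tgt = p.start then some (DPath.cons ε p h) else none).elim 0 ket = _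
  split_ifs <;> rfl

theorem annihilation_nil (ε : DEdge G) (x : V(G)) :
    adjoint (creation ε) (ket (DPath.nil x)) = 0 := by
  rw [creation, adjoint_shift, shift_ket]; rfl

theorem annihilation_cons (ε δ : DEdge G) (p : DPath G) (h : δ.tgt = p.start) :
    adjoint (creation ε) (ket (DPath.cons δ p h)) = if δ = ε then ket p else 0 := by
  rw [creation, adjoint_shift, shift_ket]
  change (if e : δ = ε then some (⟨ε.tgt, p.edges, _⟩ : DPath G) else none).elim 0 ket = _
  split_ifs with e
  · subst e
    exact congrArg ket (DPath.ext h rfl)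
  · rfl

theorem rightCreation_ket (ε : DEdge G) (p : DPath G) :
    rightCreation ε (ket p) = if h : p.finish = ε.src then ket (p.snoc ε h) else 0 := by
  rw [rightCreation, shift_ket]
  change (if h : p.finish = ε.src then some (p.snoc ε h) else none).elim 0 ket = _
  split_ifs <;> rfl

theorem rightAnnihilation_ket (ε : DEdge G) (p : DPath G) :
    adjoint (rightCreation ε) (ket p) = 0 ∨
      ∃ q : DPath G, q.length < p.length ∧ adjoint (rightCreation ε) (ket p) = ket q := by
  rw [rightCreation, adjoint_shift, shift_ket]
  rcases h : (snocPEquiv ε).symm p with _ | q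
  · exact Or.inl rfl
  · refine Or.inr ⟨q, ?_, rfl⟩
    have h1 : (if h : q.finish = ε.src then some (q.snoc ε h) else none) = some p :=
      (PEquiv.eq_some_iff _).1 h
    split_ifs at h1
    rw [Option.some.injEq] at h1
    rw [← h1, DPath.length_snoc]
    exact Nat.lt_succ_self _

theorem rightAnnihilation_vac (ε : DEdge G) (x : V(G)) :
    adjoint (rightCreation ε) (vac x) = 0 := by
  rcases rightAnnihilation_ket ε (DPath.nil x) with h | ⟨q, h, -⟩
  · exact h
  · exact absurd h (Nat.not_lt_zero _)

/-! ### Relations between the left and the right operators -/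

theorem vertexProj_mul_creation (x : V(G)) (ε : DEdge G) :
    vertexProj x * creation ε = if ε.src = x then creation ε else 0 := by
  refine ket_ext fun p => ?_
  by_cases h : ε.tgt = p.start <;> by_cases h' : ε.src = x <;>
    simp [creation_ket, vertexProj_ket, h, h']

theorem creation_mul_vertexProj (x : V(G)) (ε : DEdge G) :
    creation ε * vertexProj x = if ε.tgt = x then creation ε else 0 := by
  refine ket_ext fun p => ?_
  by_cases h : p.start = x
  · subst h
    by_cases h' : ε.tgt = p.start <;>
      simp [creation_ket, vertexProj_ket, h']
  · by_cases h' : ε.tgt = x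
    · simp [creation_ket, vertexProj_ket, h, h', Ne.symm h]
    · simp [vertexProj_ket, h, h']

theorem vertexProj_mul_vertexProj (x y : V(G)) :
    vertexProj x * vertexProj y = if x = y then vertexProj x else 0 := by
  refine ket_ext fun p => ?_
  by_cases h : x = y
  · subst h
    by_cases h : p.start = x <;> simp [vertexProj_ket, h]
  · by_cases h' : p.start = y
    · simp [vertexProj_ket, h, h', Ne.symm h]
    · simp [vertexProj_ket, h, h']

theorem sum_vertexProj [Fintype V(G)] : ∑ x : V(G), vertexProj x = (1 : FockSpace G →L[ℂ] _) := by
  refine ket_ext fun p => ?_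
  simp [vertexProj_ket]

theorem vertexProj_mul_rightCreation (x : V(G)) (ε : DEdge G) :
    vertexProj x * rightCreation ε = rightCreation ε * vertexProj x := by
  refine ket_ext fun p => ?_
  by_cases h : p.finish = ε.src <;> by_cases h' : p.start = x <;>
    simp [rightCreation_ket, vertexProj_ket, h, h']

theorem creation_mul_rightCreation (δ ε : DEdge G) :
    creation δ * rightCreation ε = rightCreation ε * creation δ := by
  refine ket_ext fun p => ?_
  by_cases h : p.finish = ε.src <;> by_cases h' : δ.tgt = p.start <;>
    simp [rightCreation_ket, creation_ket, h, h',
      DPath.snoc_cons]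

/-- The two ends of a path interfere only when the path is empty: appending `ε` to the vertex
`ε.src` creates a first edge that `δ` may then remove. This is the rank-one defect. -/
theorem annihilation_mul_rightCreation (δ ε : DEdge G) :
    adjoint (creation δ) * rightCreation ε = rightCreation ε * adjoint (creation δ)
      + if δ = ε then InnerProductSpace.rankOne ℂ (vac ε.tgt) (vac ε.src) else 0 := by
  refine ket_ext fun p => ?_
  induction p using DPath.induction_cons with
  | nil x =>
    by_cases h : x = ε.src
    · subst h
      by_cases h' : δ = ε
      · subst h'
        simp [rightCreation_ket, annihilation_nil,
          DPath.snoc_nil, annihilation_cons, vac, norm_ket]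
      · simp [rightCreation_ket, annihilation_nil,
          DPath.snoc_nil, annihilation_cons, h', Ne.symm h']
    · have h2 : DPath.nil ε.src ≠ DPath.nil x := fun e => h (congrArg DPath.start e).symm
      by_cases h' : δ = ε
      · simp [rightCreation_ket, annihilation_nil, h, h', vac,
          inner_ket_ket, h2]
      · simp [rightCreation_ket, annihilation_nil, h, h']
  | cons γ p h _ =>
    have h2 : ∀ x, DPath.nil x ≠ DPath.cons γ p h := fun x e => DPath.cons_ne_nil e.symm
    have h3 : (if δ = ε then InnerProductSpace.rankOne ℂ (vac ε.tgt) (vac ε.src) else 0 :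
        FockSpace G →L[ℂ] FockSpace G) (ket (DPath.cons γ p h)) = 0 := by
      split_ifs <;> simp [vac, inner_ket_ket, h2]
    rw [add_apply, h3]
    by_cases h' : p.finish = ε.src <;> by_cases h4 : γ = δ <;>
      simp [rightCreation_ket, h', annihilation_cons,
        DPath.snoc_cons, h4]

theorem vertexProj_mul_rightAnnihilation (x : V(G)) (ε : DEdge G) :
    vertexProj x * adjoint (rightCreation ε) = adjoint (rightCreation ε) * vertexProj x := by
  have := congrArg star (vertexProj_mul_rightCreation x ε)
  simpa only [star_mul, ContinuousLinearMap.star_eq_adjoint, adjoint_vertexProj] using this.symm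

theorem annihilation_mul_rightAnnihilation (δ ε : DEdge G) :
    adjoint (creation δ) * adjoint (rightCreation ε) =
      adjoint (rightCreation ε) * adjoint (creation δ) := by
  have := congrArg star (creation_mul_rightCreation δ ε)
  simpa only [star_mul, ContinuousLinearMap.star_eq_adjoint] using this.symm

theorem creation_mul_rightAnnihilation (δ ε : DEdge G) :
    creation δ * adjoint (rightCreation ε) = adjoint (rightCreation ε) * creation δ
      - if δ = ε then InnerProductSpace.rankOne ℂ (vac ε.src) (vac ε.tgt) else 0 := by
  have := congrArg star (annihilation_mul_rightCreation δ ε)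
  rw [star_add, star_mul, star_mul, apply_ite star, star_zero] at this
  simp only [ContinuousLinearMap.star_eq_adjoint, ContinuousLinearMap.adjoint_adjoint,
    InnerProductSpace.adjoint_rankOne] at this
  rw [this, add_sub_cancel_right]

/-! ### The generators and their commutant -/

section Generators

variable (μ : V(G) → ℝ)

theorem weightRatio_pos {μ : V(G) → ℝ} (hμ : ∀ x, 0 < μ x) (ε : DEdge G) :
    0 < weightRatio μ ε := Real.rpow_pos_of_pos (div_pos (hμ _) (hμ _)) _

theorem weightRatio_op {μ : V(G) → ℝ} (hμ : ∀ x, 0 < μ x) (ε : DEdge G) :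
    weightRatio μ ε.op = (weightRatio μ ε)⁻¹ := by
  rw [weightRatio, weightRatio, ← Real.inv_rpow (div_pos (hμ _) (hμ _)).le, inv_div]
  rfl

theorem mul_weightRatio_pow {μ : V(G) → ℝ} (hμ : ∀ x, 0 < μ x) (ε : DEdge G) :
    μ ε.tgt * weightRatio μ ε ^ 4 = μ ε.src := by
  rw [weightRatio, ← Real.rpow_natCast, ← Real.rpow_mul (div_pos (hμ _) (hμ _)).le]
  norm_num
  rw [mul_div_cancel₀ _ (hμ _).ne']

theorem star_arcOp {μ : V(G) → ℝ} (hμ : ∀ x, 0 < μ x) (ε : DEdge G) :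
    star (arcOp μ ε) = arcOp μ ε.op := by
  rw [arcOp, arcOp, weightRatio_op hμ, star_add, star_smul, star_smul, DEdge.op_op]
  simp [ContinuousLinearMap.star_eq_adjoint, add_comm]

/-- The generators of the commutant: the mirror images of the operators `X_ε`. -/
def rightOp (ε : DEdge G) : FockSpace G →L[ℂ] FockSpace G :=
  ((weightRatio μ ε)⁻¹ : ℂ) • rightCreation ε
    + (weightRatio μ ε : ℂ) • adjoint (rightCreation ε.op)

theorem vertexProj_mul_rightOp (x : V(G)) (ε : DEdge G) :
    vertexProj x * rightOp μ ε = rightOp μ ε * vertexProj x := by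
  simp only [rightOp, mul_add, add_mul, mul_smul_comm, smul_mul_assoc,
    vertexProj_mul_rightCreation, vertexProj_mul_rightAnnihilation]

theorem star_rightOp {μ : V(G) → ℝ} (hμ : ∀ x, 0 < μ x) (ε : DEdge G) :
    star (rightOp μ ε) = rightOp μ ε.op := by
  rw [rightOp, rightOp, weightRatio_op hμ, star_add, star_smul, star_smul, DEdge.op_op]
  simp [ContinuousLinearMap.star_eq_adjoint, add_comm]

/-- For `δ = ε.op` both mixed products have the same rank-one defect, with opposite signs. The
inverse weights in `rightOp` make both coefficients equal to `1`, so the defects cancel. -/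
theorem arcOp_mul_rightOp {μ : V(G) → ℝ} (hμ : ∀ x, 0 < μ x) (δ ε : DEdge G) :
    arcOp μ δ * rightOp μ ε = rightOp μ ε * arcOp μ δ := by
  have h1 := creation_mul_rightAnnihilation δ ε.op
  have h2 := annihilation_mul_rightCreation δ.op ε
  by_cases h : δ = ε.op
  · subst h
    have e1 : ε.op.src = ε.tgt := rfl
    have e2 : ε.op.tgt = ε.src := rfl
    rw [if_pos rfl, e1, e2] at h1
    rw [if_pos (DEdge.op_op ε)] at h2
    generalize InnerProductSpace.rankOne ℂ (vac (G := G) ε.tgt) (vac ε.src) = K at h1 h2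
    have h3 : (weightRatio μ ε : ℂ) ≠ 0 := by exact_mod_cast (weightRatio_pos hμ ε).ne'
    simp only [arcOp, rightOp, mul_add, add_mul, mul_smul_comm, smul_mul_assoc, h1, h2,
      creation_mul_rightCreation, annihilation_mul_rightAnnihilation, weightRatio_op hμ,
      smul_add, smul_sub, smul_smul]
    push_cast
    rw [inv_inv, inv_mul_cancel₀ h3, mul_inv_cancel₀ h3]
    abel
  · have h' : δ.op ≠ ε := fun e => h (by rw [← e]; rfl)
    rw [if_neg h, sub_zero] at h1
    rw [if_neg h', add_zero] at h2
    simp only [arcOp, rightOp, mul_add, add_mul, mul_smul_comm, smul_mul_assoc, h1, h2,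
      creation_mul_rightCreation, annihilation_mul_rightAnnihilation, smul_add, smul_smul,
      mul_comm]
    abel

/-- Without its creation part the right operator no longer commutes, and the remaining rank-one
commutator singles out the letter `ε`. This is what lowers degrees later. -/
theorem arcOp_mul_rightAnnihilation (δ ε : DEdge G) :
    arcOp μ δ * adjoint (rightCreation ε) = adjoint (rightCreation ε) * arcOp μ δ
      - if δ = ε then
          (weightRatio μ ε : ℂ) • InnerProductSpace.rankOne ℂ (vac ε.src) (vac ε.tgt) else 0 := by
  simp only [arcOp, mul_add, add_mul, mul_smul_comm, smul_mul_assoc,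
    annihilation_mul_rightAnnihilation, creation_mul_rightAnnihilation, smul_sub]
  split_ifs with h
  · subst h; abel
  · simp

theorem vertexProj_mul_arcOp (x : V(G)) (ε : DEdge G) :
    vertexProj x * arcOp μ ε = if ε.src = x then arcOp μ ε else 0 := by
  have h := congrArg star (creation_mul_vertexProj x ε.op)
  rw [star_mul, apply_ite star, star_zero] at h
  simp only [ContinuousLinearMap.star_eq_adjoint, adjoint_vertexProj] at h
  rw [arcOp, mul_add, mul_smul_comm, mul_smul_comm, vertexProj_mul_creation, h]
  change _ • _ + _ • (if ε.src = x then _ else _) = _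
  split_ifs <;> simp

theorem arcOp_mul_vertexProj (x : V(G)) (ε : DEdge G) :
    arcOp μ ε * vertexProj x = if ε.tgt = x then arcOp μ ε else 0 := by
  have h := congrArg star (vertexProj_mul_creation x ε.op)
  rw [star_mul, apply_ite star, star_zero] at h
  simp only [ContinuousLinearMap.star_eq_adjoint, adjoint_vertexProj] at h
  rw [arcOp, add_mul, smul_mul_assoc, smul_mul_assoc, creation_mul_vertexProj, h]
  change _ • _ + _ • (if ε.tgt = x then _ else _) = _
  split_ifs <;> simp

/-- The commutant of the operators `rightOp μ ε`. -/
def rightCommutant : StarSubalgebra ℂ (FockSpace G →L[ℂ] FockSpace G) :=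
  StarSubalgebra.centralizer ℂ (Set.range (rightOp μ))

variable {μ}

theorem mem_rightCommutant (hμ : ∀ x, 0 < μ x) {S : FockSpace G →L[ℂ] FockSpace G} :
    S ∈ rightCommutant μ ↔ ∀ ε, rightOp μ ε * S = S * rightOp μ ε := by
  rw [rightCommutant, StarSubalgebra.mem_centralizer_iff]
  constructor
  · exact fun h ε => (h _ ⟨ε, rfl⟩).1
  · rintro h _ ⟨ε, rfl⟩
    rw [star_rightOp hμ]
    exact ⟨h ε, h _⟩

theorem vertexProj_mem_rightCommutant (hμ : ∀ x, 0 < μ x) (x : V(G)) :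
    vertexProj x ∈ rightCommutant μ :=
  (mem_rightCommutant hμ).2 fun ε => (vertexProj_mul_rightOp μ x ε).symm

theorem arcOp_mem_rightCommutant (hμ : ∀ x, 0 < μ x) (ε : DEdge G) :
    arcOp μ ε ∈ rightCommutant μ :=
  (mem_rightCommutant hμ).2 fun δ => (arcOp_mul_rightOp hμ ε δ).symm

theorem polyAlgebra_le_rightCommutant (hμ : ∀ x, 0 < μ x) :
    polyAlgebra G μ ≤ (rightCommutant μ).toSubalgebra := by
  refine Algebra.adjoin_le ?_
  rintro _ (⟨x, rfl⟩ | ⟨ε, rfl⟩)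
  · exact vertexProj_mem_rightCommutant hμ x
  · exact arcOp_mem_rightCommutant hμ ε

theorem edgeOp_mem_rightCommutant (hμ : ∀ x, 0 < μ x) (ε : DEdge G) :
    edgeOp μ ε ∈ rightCommutant μ := by
  rw [edgeOp]
  split_ifs with h
  · have h1 : creation ε + adjoint (creation ε) = arcOp μ ε := by
      rw [arcOp, DEdge.op_eq_self h, weightRatio, h, div_self (hμ _).ne', Real.one_rpow]
      simp
    rw [h1]
    exact arcOp_mem_rightCommutant hμ ε
  · exact add_mem (arcOp_mem_rightCommutant hμ ε) (arcOp_mem_rightCommutant hμ ε.op)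

theorem freeGraphAlgebra_le_rightCommutant (hμ : ∀ x, 0 < μ x) :
    freeGraphAlgebra G μ ≤ rightCommutant μ := by
  refine StarSubalgebra.topologicalClosure_minimal (StarAlgebra.adjoin_le ?_)
    (Set.isClosed_centralizer _)
  rintro _ (⟨x, rfl⟩ | ⟨ε, rfl⟩)
  · exact vertexProj_mem_rightCommutant hμ x
  · exact edgeOp_mem_rightCommutant hμ ε

theorem vonNeumann_subset_rightCommutant (hμ : ∀ x, 0 < μ x) {a : FockSpace G →L[ℂ] FockSpace G}
    (ha : a ∈ vonNeumann G μ) : a ∈ rightCommutant μ := by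
  rw [mem_rightCommutant hμ]
  intro ε
  have ha' : a ∈ StarSubalgebra.centralizer ℂ
      (StarSubalgebra.centralizer ℂ (freeGraphAlgebra G μ : Set (FockSpace G →L[ℂ] FockSpace G)) :
      Set (FockSpace G →L[ℂ] FockSpace G)) := ha
  rw [StarSubalgebra.mem_centralizer_iff] at ha'
  refine (ha' _ ?_).1
  rw [SetLike.mem_coe, StarSubalgebra.mem_centralizer_iff]
  intro S hS
  have h1 := (mem_rightCommutant hμ).1 (freeGraphAlgebra_le_rightCommutant hμ hS) ε
  have h2 := (mem_rightCommutant hμ).1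
    (freeGraphAlgebra_le_rightCommutant hμ (star_mem hS)) ε
  exact ⟨h1.symm, h2.symm⟩

/-- The vacuum vectors are separating for the commutant of the right operators. -/
theorem eq_zero_of_vac (hμ : ∀ x, 0 < μ x) {S : FockSpace G →L[ℂ] FockSpace G}
    (hS : S ∈ rightCommutant μ) (h : ∀ x, S (vac x) = 0) : S = 0 := by
  rw [mem_rightCommutant hμ] at hS
  have key : ∀ n, ∀ p : DPath G, p.length = n → S (ket p) = 0 := by
    intro n
    -- `rightOp μ ε` sends `q` to a nonzero multiple of `q ε` plus a term on a shorter path; as `S`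
    -- commutes with it, vanishing on shorter paths propagates to `q ε`.
    induction n using Nat.strong_induction_on with
    | _ n ih =>
      intro p hp
      by_cases h0 : p.length = 0
      · induction p using DPath.induction_cons with
        | nil x => exact h x
        | cons => simp at h0
      · obtain ⟨q, ε, hq, rfl⟩ := p.exists_snoc h0
        have hlt : q.length < n := by rw [← hp, DPath.length_snoc]; exact Nat.lt_succ_self _
        have h1 : S (adjoint (rightCreation ε.op) (ket q)) = 0 := by
          rcases rightAnnihilation_ket ε.op q with h2 | ⟨r, hr, h2⟩
          · rw [h2, map_zero]
          · rw [h2, ih _ (hr.trans hlt) _ rfl]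
        have h3 := congrArg (fun A => A (ket q)) (hS ε)
        have h4 : (weightRatio μ ε : ℂ) ≠ 0 := by exact_mod_cast (weightRatio_pos hμ ε).ne'
        simp only [mul_apply_eq_comp, ih _ hlt q rfl, map_zero, rightOp,
          add_apply, smul_apply, map_add, map_smul, h1, smul_zero, add_zero, rightCreation_ket,
          dif_pos hq] at h3
        exact (smul_eq_zero.1 h3.symm).resolve_left (inv_ne_zero h4)
  refine ket_ext fun p => ?_
  rw [key _ p rfl]; rfl

end Generators

/-! ### The trace -/

section Trace

variable {μ : V(G) → ℝ}

theorem norm_vac (x : V(G)) : ‖(vac x : FockSpace G)‖ = 1 := norm_ket _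

theorem inner_vac_vac (x y : V(G)) :
    inner ℂ (vac x : FockSpace G) (vac y) = if x = y then (1 : ℂ) else 0 := by
  rw [vac, vac, inner_ket_ket]
  congr 1
  exact propext ⟨fun h => congrArg DPath.start h, fun h => congrArg _ h⟩

theorem vertexProj_vac (x y : V(G)) :
    vertexProj x (vac y) = if y = x then vac y else 0 := vertexProj_ket _ _

theorem condExpect_eq (S : FockSpace G →L[ℂ] FockSpace G) (x : V(G)) :
    condExpect S x = inner ℂ (vac x) (S (vac x)) := rfl

theorem arcOp_vac (ε : DEdge G) (x : V(G)) :
    arcOp μ ε (vac x) = if ε.tgt = x then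
      (weightRatio μ ε : ℂ) • ket (DPath.cons ε (DPath.nil ε.tgt) (DPath.start_nil ε.tgt).symm)
      else 0 := by
  simp only [arcOp, add_apply, smul_apply, vac, annihilation_nil, smul_zero, add_zero,
    creation_ket]
  by_cases h : ε.tgt = x
  · subst h; simp
  · simp [h]

theorem rightOp_vac (ε : DEdge G) (x : V(G)) :
    rightOp μ ε (vac x) = if x = ε.src then
      ((weightRatio μ ε)⁻¹ : ℂ) • ket (DPath.cons ε (DPath.nil ε.tgt) (DPath.start_nil ε.tgt).symm)
      else 0 := by
  simp only [rightOp, add_apply, smul_apply, rightAnnihilation_vac, smul_zero, add_zero]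
  rw [vac, rightCreation_ket]
  by_cases h : x = ε.src
  · subst h
    rw [dif_pos (DPath.finish_nil _), DPath.snoc_nil, if_pos rfl]
  · rw [dif_neg (show ¬(DPath.nil x).finish = ε.src from h), if_neg h, smul_zero]

variable [Fintype V(G)]

theorem Tr_add (S T : FockSpace G →L[ℂ] FockSpace G) : Tr μ (S + T) = Tr μ S + Tr μ T := by
  simp [Tr, condExpect, mul_add, Finset.sum_add_distrib]

theorem Tr_smul (c : ℂ) (S : FockSpace G →L[ℂ] FockSpace G) : Tr μ (c • S) = c * Tr μ S := by
  simp [Tr, condExpect, Finset.mul_sum, mul_left_comm]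

/-- Each side reduces to a single matrix coefficient of `S`, with factor `μ(s) a⁻¹` on one side and
`μ(t) a` on the other, where `a = a_ε`, `s = ε.src` and `t = ε.tgt`. Commutation with `rightOp μ ε`
relates the two coefficients by `a²`, so the claim becomes `μ(t) a⁴ = μ(s)`: this is the reason for
the exponent `1/4`. -/
theorem Tr_mul_comm_arcOp (hμ : ∀ x, 0 < μ x) (ε : DEdge G)
    {S : FockSpace G →L[ℂ] FockSpace G} (hS : S ∈ rightCommutant μ) :
    Tr μ (arcOp μ ε * S) = Tr μ (S * arcOp μ ε) := by
  have h4 : (weightRatio μ ε : ℂ) ≠ 0 := by exact_mod_cast (weightRatio_pos hμ ε).ne'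
  set k : FockSpace G := ket (DPath.cons ε (DPath.nil ε.tgt) (DPath.start_nil ε.tgt).symm) with hk
  set k' : FockSpace G :=
    ket (DPath.cons ε.op (DPath.nil ε.op.tgt) (DPath.start_nil ε.op.tgt).symm) with hk'
  have h1 : Tr μ (arcOp μ ε * S) =
      (μ ε.src : ℂ) * ((weightRatio μ ε : ℂ)⁻¹ * inner ℂ k' (S (vac ε.src))) := by
    have : ∀ x, condExpect (arcOp μ ε * S) x =
        if x = ε.src then ((weightRatio μ ε : ℂ)⁻¹ * inner ℂ k' (S (vac ε.src)) : ℂ) else 0 := by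
      intro x
      rw [condExpect_eq, mul_apply_eq_comp,
        ← ContinuousLinearMap.adjoint_inner_left, ← ContinuousLinearMap.star_eq_adjoint,
        star_arcOp hμ, arcOp_vac, weightRatio_op hμ]
      change inner ℂ (if ε.src = x then _ else _) _ = _
      by_cases h : x = ε.src
      · subst h
        rw [if_pos rfl, if_pos rfl, inner_smul_left, Complex.conj_ofReal, Complex.ofReal_inv]
      · rw [if_neg h, if_neg (Ne.symm h), inner_zero_left]
    simp [Tr, this]
  have h2 : Tr μ (S * arcOp μ ε) =
      (μ ε.tgt : ℂ) * (weightRatio μ ε * inner ℂ (vac ε.tgt) (S k)) := by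
    have : ∀ x, condExpect (S * arcOp μ ε) x =
        if x = ε.tgt then (weightRatio μ ε * inner ℂ (vac ε.tgt) (S k) : ℂ) else 0 := by
      intro x
      rw [condExpect_eq, mul_apply_eq_comp, arcOp_vac]
      by_cases h : x = ε.tgt
      · subst h
        rw [if_pos rfl, if_pos rfl, map_smul, inner_smul_right]
      · rw [if_neg h, if_neg (Ne.symm h), map_zero, inner_zero_right]
    simp [Tr, this]
  have h3 : (weightRatio μ ε : ℂ)⁻¹ * inner ℂ (vac ε.tgt) (S k) =
      weightRatio μ ε * inner ℂ k' (S (vac ε.src)) := by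
    have e1 : (weightRatio μ ε : ℂ)⁻¹ • k = rightOp μ ε (vac ε.src) := by
      rw [rightOp_vac, if_pos rfl]
    have e2 : (weightRatio μ ε : ℂ) • k' = rightOp μ ε.op (vac ε.tgt) := by
      rw [rightOp_vac, weightRatio_op hμ]
      simp [DEdge.op, hk']
    have e3 := congrArg (fun A => A (vac ε.src)) ((mem_rightCommutant hμ).1 hS ε)
    simp only [mul_apply_eq_comp] at e3
    rw [← inner_smul_right, ← map_smul, e1, ← e3, ← ContinuousLinearMap.adjoint_inner_left,
      ← ContinuousLinearMap.star_eq_adjoint, star_rightOp hμ, ← e2, inner_smul_left]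
    simp
  rw [h1, h2]
  have h5 : (μ ε.tgt : ℂ) * (weightRatio μ ε : ℂ) ^ 4 = μ ε.src := by
    exact_mod_cast mul_weightRatio_pow hμ ε
  have h6 : inner ℂ (vac ε.tgt) (S k) =
      (weightRatio μ ε : ℂ) ^ 2 * inner ℂ k' (S (vac ε.src)) := by
    field_simp at h3
    exact h3
  rw [h6, ← h5]
  field_simp

/-- The trace property, with one factor a polynomial. -/
theorem Tr_mul_comm (hμ : ∀ x, 0 < μ x) {T : FockSpace G →L[ℂ] FockSpace G}
    (hT : T ∈ polyAlgebra G μ) :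
    ∀ S ∈ rightCommutant μ, Tr μ (T * S) = Tr μ (S * T) := by
  induction hT using Algebra.adjoin_induction with
  | mem T h =>
    intro S hS
    rcases h with ⟨x, rfl⟩ | ⟨ε, rfl⟩
    · refine Finset.sum_congr rfl fun y _ => ?_
      rw [condExpect_eq, condExpect_eq, mul_apply_eq_comp, mul_apply_eq_comp,
        ← ContinuousLinearMap.adjoint_inner_left,
        adjoint_vertexProj, vertexProj_vac]
      split_ifs <;> simp
    · exact Tr_mul_comm_arcOp hμ ε hS
  | algebraMap c => intro S _; rw [Algebra.commutes]
  | add A B _ _ hA hB => intro S hS; rw [add_mul, mul_add, Tr_add, Tr_add, hA S hS, hB S hS]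
  | mul A B hA' hB' hA hB =>
    intro S hS
    have hA'' := polyAlgebra_le_rightCommutant hμ hA'
    have hB'' := polyAlgebra_le_rightCommutant hμ hB'
    rw [mul_assoc, hA _ (mul_mem hB'' hS), mul_assoc, hB _ (mul_mem hS hA''), mul_assoc]

end Trace

/-! ### Resolvents and kernels -/

section Resolvent

variable {H : Type*} [NormedAddCommGroup H] [InnerProductSpace ℂ H] [CompleteSpace H]

/-- The operator `(1 + t T* T)⁻¹`. -/
def resolv (T : H →L[ℂ] H) (t : ℝ) : H →L[ℂ] H := Ring.inverse (1 + (t : ℂ) • (star T * T))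

theorem inner_one_add_smul (T : H →L[ℂ] H) (t : ℝ) (f : H) :
    inner ℂ ((1 + (t : ℂ) • (star T * T)) f) f = ((‖f‖ ^ 2 + t * ‖T f‖ ^ 2 : ℝ) : ℂ) := by
  rw [add_apply, inner_add_left, smul_apply, inner_smul_left, mul_apply_eq_comp,
    ContinuousLinearMap.star_eq_adjoint, ContinuousLinearMap.adjoint_inner_left]
  simp [inner_self_eq_norm_sq_to_K]

theorem isUnit_one_add_smul (T : H →L[ℂ] H) {t : ℝ} (ht : 0 ≤ t) :
    IsUnit (1 + (t : ℂ) • (star T * T)) := by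
  refine ContinuousLinearMap.isUnit_of_forall_le_norm_inner_map _ (c := 1) one_pos fun f => ?_
  rw [inner_one_add_smul, Complex.norm_real, Real.norm_of_nonneg (by positivity)]
  simp only [NNReal.coe_one, mul_one]
  nlinarith [mul_nonneg ht (sq_nonneg ‖T f‖)]

theorem resolv_mul (T : H →L[ℂ] H) {t : ℝ} (ht : 0 ≤ t) :
    resolv T t * (1 + (t : ℂ) • (star T * T)) = 1 :=
  Ring.inverse_mul_cancel _ (isUnit_one_add_smul T ht)

theorem mul_resolv (T : H →L[ℂ] H) {t : ℝ} (ht : 0 ≤ t) :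
    (1 + (t : ℂ) • (star T * T)) * resolv T t = 1 :=
  Ring.mul_inverse_cancel _ (isUnit_one_add_smul T ht)

theorem star_resolv (T : H →L[ℂ] H) (t : ℝ) : star (resolv T t) = resolv T t := by
  rw [resolv, ← Ring.inverse_star]
  simp

theorem norm_sq_resolv_le (T : H →L[ℂ] H) {t : ℝ} (ht : 0 ≤ t) (f : H) :
    ‖resolv T t f‖ ^ 2 ≤ (inner ℂ f (resolv T t f)).re := by
  have h := inner_one_add_smul T t (resolv T t f)
  rw [← mul_apply_eq_comp, mul_resolv T ht, one_apply_eq_self] at h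
  rw [h, Complex.ofReal_re]
  nlinarith [mul_nonneg ht (sq_nonneg ‖T (resolv T t f)‖)]

theorem norm_resolv_le (T : H →L[ℂ] H) {t : ℝ} (ht : 0 ≤ t) (f : H) :
    ‖resolv T t f‖ ≤ ‖f‖ := by
  have h1 := norm_sq_resolv_le T ht f
  have h2 := (Complex.re_le_norm _).trans (norm_inner_le_norm (𝕜 := ℂ) f (resolv T t f))
  by_contra! h
  nlinarith [norm_nonneg f]

theorem resolv_apply_eq_self (T : H →L[ℂ] H) {t : ℝ} (ht : 0 ≤ t) {f : H} (hf : T f = 0) :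
    resolv T t f = f := by
  have h := congrArg (fun A => A f) (resolv_mul T ht)
  simpa [mul_apply_eq_comp, hf] using h

/-- The self-adjoint resolvent fixes `ξ`, so Cauchy–Schwarz gives a lower bound uniform in `t`.
Together with `kerProj_apply_ne_zero` this avoids taking the limit of the resolvents, which is the
kernel projection. -/
theorem norm_inner_sq_le_resolv (T : H →L[ℂ] H) {t : ℝ} (ht : 0 ≤ t) {ξ : H} (hξ : T ξ = 0)
    (f : H) : ‖inner ℂ ξ f‖ ^ 2 ≤ ‖ξ‖ ^ 2 * (inner ℂ f (resolv T t f)).re := by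
  have h1 : inner ℂ ξ f = inner ℂ ξ (resolv T t f) := by
    rw [← ContinuousLinearMap.adjoint_inner_left, ← ContinuousLinearMap.star_eq_adjoint,
      star_resolv, resolv_apply_eq_self T ht hξ]
  calc ‖inner ℂ ξ f‖ ^ 2 ≤ (‖ξ‖ * ‖resolv T t f‖) ^ 2 := by
        rw [h1]; gcongr; exact norm_inner_le_norm _ _
    _ = ‖ξ‖ ^ 2 * ‖resolv T t f‖ ^ 2 := mul_pow _ _ _
    _ ≤ _ := by gcongr; exact norm_sq_resolv_le T ht f

/-- The orthogonal projection onto the kernel of `T`. -/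
def kerProj (T : H →L[ℂ] H) : H →L[ℂ] H := T.ker.starProjection

theorem mul_kerProj (T : H →L[ℂ] H) : T * kerProj T = 0 := by
  ext1 f
  exact T.ker.starProjection_apply_mem f

theorem star_kerProj (T : H →L[ℂ] H) : star (kerProj T) = kerProj T :=
  isSelfAdjoint_starProjection _

theorem kerProj_mul_of_mul_eq_zero {T S : H →L[ℂ] H} (h : T * S = 0) : kerProj T * S = S := by
  ext1 f
  exact Submodule.starProjection_eq_self_iff.2 (DFunLike.congr_fun h f)

theorem kerProj_mul_star (T : H →L[ℂ] H) : kerProj T * star T = 0 := by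
  have h := congrArg star (mul_kerProj T)
  rwa [star_mul, star_kerProj, star_zero] at h

/-- The kernel projection commutes with everything that commutes with `T` together with its
adjoint. -/
theorem kerProj_mul_comm {T Y : H →L[ℂ] H} (h : T * Y = Y * T) (h' : T * star Y = star Y * T) :
    kerProj T * Y = Y * kerProj T := by
  have key : ∀ Z : H →L[ℂ] H, T * Z = Z * T → kerProj T * (Z * kerProj T) = Z * kerProj T := by
    intro Z hZ
    refine kerProj_mul_of_mul_eq_zero ?_
    rw [← mul_assoc, hZ, mul_assoc, mul_kerProj, mul_zero]
  have h1 := congrArg star (key _ h')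
  simp only [star_mul, star_kerProj, star_star] at h1
  rw [← key Y h, ← mul_assoc, h1]

/-- The complement of the kernel is the closure of the range of `T* T`, and on `T* T η` the
resolvent has norm at most `2‖η‖ / t`. -/
theorem exists_resolv_lt (T : H →L[ℂ] H) {f : H} (hf : kerProj T f = 0) {c : ℝ} (hc : 0 < c) :
    ∃ t : ℝ, 0 ≤ t ∧ ‖resolv T t f‖ < c := by
  have h1 : f ∈ T.kerᗮ := (Submodule.starProjection_apply_eq_zero_iff _).1 hf
  have h2 : f ∈ closure (Set.range (star T * T)) := by
    have e : (star T * T).rangeᗮᗮ = T.kerᗮ := by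
      rw [ContinuousLinearMap.orthogonal_range, ← ContinuousLinearMap.star_eq_adjoint, star_mul,
        star_star]
      congr 1
      exact T.ker_adjoint_comp_self
    rw [← e, Submodule.orthogonal_orthogonal_eq_closure] at h1
    exact h1
  obtain ⟨_, ⟨η, rfl⟩, hη⟩ := Metric.mem_closure_iff.1 h2 (c / 2) (half_pos hc)
  rw [dist_eq_norm] at hη
  -- Chosen so that `2‖η‖ / t < c / 2`; the `+ 1` keeps `t` positive when `η = 0`.
  refine ⟨4 * (‖η‖ + 1) / c, by positivity, ?_⟩
  set t := 4 * (‖η‖ + 1) / c with ht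
  have ht0 : 0 < t := by positivity
  have h3 : (t : ℂ) • resolv T t ((star T * T) η) = η - resolv T t η := by
    have h := congrArg (fun A => A η) (resolv_mul T ht0.le)
    simp only [mul_apply_eq_comp, add_apply, one_apply_eq_self, smul_apply, map_add,
      map_smul] at h
    rw [eq_sub_iff_add_eq']
    exact h
  have h4 : t * ‖resolv T t ((star T * T) η)‖ ≤ 2 * ‖η‖ := by
    have h5 := congrArg norm h3
    rw [norm_smul, Complex.norm_real, Real.norm_of_nonneg ht0.le] at h5
    rw [h5]
    linarith [norm_sub_le η (resolv T t η), norm_resolv_le T ht0.le η]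
  have h6 : ‖resolv T t ((star T * T) η)‖ < c / 2 := by
    have h7 : t * (c / 2) = 2 * (‖η‖ + 1) := by rw [ht]; field_simp; norm_num
    by_contra! h8
    nlinarith
  calc ‖resolv T t f‖ = ‖resolv T t (f - (star T * T) η) + resolv T t ((star T * T) η)‖ := by
        rw [← map_add, sub_add_cancel]
    _ ≤ ‖f - (star T * T) η‖ + ‖resolv T t ((star T * T) η)‖ :=
        (norm_add_le _ _).trans (by gcongr; exact norm_resolv_le T ht0.le _)
    _ < c := by linarith

/-- If the resolvents are bounded below at a vector, then the vector is not orthogonal to the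
kernel. -/
theorem kerProj_apply_ne_zero (T : H →L[ℂ] H) {f : H} {c : ℝ} (hc : 0 < c)
    (h : ∀ t : ℝ, 0 ≤ t → c ≤ (inner ℂ f (resolv T t f)).re) : kerProj T f ≠ 0 := by
  intro h0
  obtain ⟨t, ht, hlt⟩ := exists_resolv_lt T h0 (c := c / (‖f‖ + 1)) (by positivity)
  have h1 := (h t ht).trans
    ((Complex.re_le_norm _).trans (norm_inner_le_norm (𝕜 := ℂ) f (resolv T t f)))
  rw [lt_div_iff₀ (by positivity)] at hlt
  nlinarith [norm_nonneg f, norm_nonneg (resolv T t f)]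

theorem inner_kerProj_ne_zero (T : H →L[ℂ] H) {f : H} (h : kerProj T f ≠ 0) :
    inner ℂ (kerProj T f) f ≠ 0 := by
  have h1 : inner ℂ (kerProj T f) f = inner ℂ (kerProj T f) (kerProj T f) := by
    have h2 : kerProj T (kerProj T f) = kerProj T f :=
      congrArg (fun A => A f) (kerProj_mul_of_mul_eq_zero (mul_kerProj T))
    rw [← ContinuousLinearMap.adjoint_inner_left, ← ContinuousLinearMap.star_eq_adjoint,
      star_kerProj, h2]
  rw [h1]
  exact inner_self_ne_zero.2 h

end Resolvent

/-! ### Comparing kernel and cokernel by means of the trace -/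

section Dimension

variable {μ : V(G) → ℝ}

theorem resolv_mem_rightCommutant {T : FockSpace G →L[ℂ] FockSpace G}
    (hT : T ∈ rightCommutant μ) {t : ℝ} (ht : 0 ≤ t) : resolv T t ∈ rightCommutant μ := by
  have h1 : 1 + (t : ℂ) • (star T * T) ∈ rightCommutant μ :=
    add_mem (one_mem _) (SMulMemClass.smul_mem _ (mul_mem (star_mem hT) hT))
  have h2 : ∀ Y : FockSpace G →L[ℂ] FockSpace G,
      Y * (1 + (t : ℂ) • (star T * T)) = (1 + (t : ℂ) • (star T * T)) * Y →
      Y * resolv T t = resolv T t * Y := by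
    intro Y hY
    calc Y * resolv T t = resolv T t * ((1 + (t : ℂ) • (star T * T)) * Y) * resolv T t := by
          rw [← mul_assoc, resolv_mul T ht, one_mul]
      _ = resolv T t * Y * ((1 + (t : ℂ) • (star T * T)) * resolv T t) := by
          rw [← hY]; simp only [mul_assoc]
      _ = resolv T t * Y := by rw [mul_resolv T ht, mul_one]
  rw [rightCommutant, StarSubalgebra.mem_centralizer_iff] at h1 ⊢
  exact fun Y hY => ⟨h2 _ (h1 Y hY).1, h2 _ (h1 Y hY).2⟩

theorem apply_vac_of_mul_vertexProj {T : FockSpace G →L[ℂ] FockSpace G} {x y : V(G)}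
    (h : T * vertexProj x = T) (hy : y ≠ x) : T (vac y) = 0 := by
  rw [← h, mul_apply_eq_comp, vertexProj_vac, if_neg hy, map_zero]

variable [Fintype V(G)]

/-- Write `R` and `R'` for the resolvents of `T` and `star T`. Then `1 - R' = t T T* R'` and `1 - R
= t T* T R`, and since `R' T = T R` these differ by moving the polynomial `T` around the trace. -/
theorem Tr_resolv_star (hμ : ∀ x, 0 < μ x) {T : FockSpace G →L[ℂ] FockSpace G}
    (hT : T ∈ polyAlgebra G μ) {t : ℝ} (ht : 0 ≤ t) :
    Tr μ (resolv (star T) t) = Tr μ (resolv T t) := by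
  have hN : T ∈ rightCommutant μ := polyAlgebra_le_rightCommutant hμ hT
  have e1 : (t : ℂ) • (T * (star T * resolv (star T) t)) = 1 - resolv (star T) t := by
    have h := mul_resolv (star T) ht
    rw [star_star, add_mul, one_mul, smul_mul_assoc, mul_assoc] at h
    exact eq_sub_of_add_eq' h
  have e2 : (t : ℂ) • (star T * T * resolv T t) = 1 - resolv T t := by
    have h := mul_resolv T ht
    rw [add_mul, one_mul, smul_mul_assoc] at h
    exact eq_sub_of_add_eq' h
  have e3 : resolv (star T) t * T = T * resolv T t := by
    have h1 := resolv_mul (star T) ht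
    rw [star_star] at h1
    calc resolv (star T) t * T =
          resolv (star T) t * (T * ((1 + (t : ℂ) • (star T * T)) * resolv T t)) := by
          rw [mul_resolv T ht, mul_one]
      _ = resolv (star T) t * (1 + (t : ℂ) • (T * star T)) * (T * resolv T t) := by
          simp only [mul_add, add_mul, mul_one, one_mul, mul_smul_comm, smul_mul_assoc,
            mul_assoc]
      _ = T * resolv T t := by rw [h1, one_mul]
  have e4 := Tr_mul_comm hμ hT (star T * resolv (star T) t)
    (mul_mem (star_mem hN) (resolv_mem_rightCommutant (star_mem hN) ht))
  rw [mul_assoc, e3, ← mul_assoc (star T)] at e4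
  have e5 : ∀ S : FockSpace G →L[ℂ] FockSpace G, Tr μ (1 - S) = Tr μ 1 + (-1 : ℂ) * Tr μ S := by
    intro S
    rw [← Tr_smul, ← Tr_add, neg_one_smul, sub_eq_add_neg]
  have e6 := congrArg (fun z => (t : ℂ) * z) e4
  simp only [← Tr_smul] at e6
  rw [e1, e2, e5, e5] at e6
  linear_combination -e6

/-- The resolvent of an operator supported on the corner at `x` fixes the other vacuum vectors, so
its trace carries information in one term only. -/
theorem Tr_eq_of_vac {S : FockSpace G →L[ℂ] FockSpace G} {x : V(G)}
    (h : ∀ y ≠ x, S (vac y) = vac y) :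
    Tr μ S = ∑ y, (μ y : ℂ) + μ x * (inner ℂ (vac x) (S (vac x)) - 1) := by
  have h1 : ∀ y, (μ y : ℂ) * condExpect S y =
      μ y + if y = x then (μ x : ℂ) * (inner ℂ (vac x) (S (vac x)) - 1) else 0 := by
    intro y
    rw [condExpect_eq]
    by_cases hy : y = x
    · subst hy; rw [if_pos rfl]; ring
    · rw [h y hy, if_neg hy, inner_vac_vac, if_pos rfl, mul_one, add_zero]
  simp only [Tr, h1, Finset.sum_add_distrib, Finset.sum_ite_eq', Finset.mem_univ, if_true]

/-- Comparison of dimensions: an operator from the corner of least trace to another corner that has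
a kernel has a cokernel. -/
theorem kerProj_star_vac_ne_zero (hμ : ∀ x, 0 < μ x) {T : FockSpace G →L[ℂ] FockSpace G}
    (hT : T ∈ polyAlgebra G μ) {x y : V(G)} (hxy : μ x ≤ μ y) (hx : T * vertexProj x = T)
    (hy : vertexProj y * T = T) {ξ : FockSpace G} (hξ : T ξ = 0) (h0 : inner ℂ ξ (vac x) ≠ 0) :
    kerProj (star T) (vac y) ≠ 0 := by
  have hξ0 : 0 < ‖ξ‖ := norm_pos_iff.2 fun h => h0 (by rw [h, inner_zero_left])
  refine kerProj_apply_ne_zero _ (c := ‖inner ℂ ξ (vac x)‖ ^ 2 / ‖ξ‖ ^ 2)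
    (div_pos (pow_pos (norm_pos_iff.2 h0) 2) (pow_pos hξ0 2)) fun t ht => ?_
  have h1 := norm_inner_sq_le_resolv T ht hξ (vac x)
  rw [div_le_iff₀' (by positivity)]
  refine h1.trans (mul_le_mul_of_nonneg_left ?_ (sq_nonneg _))
  have hy' : star T * vertexProj y = star T := by
    have h := congrArg star hy
    rwa [star_mul, ContinuousLinearMap.star_eq_adjoint (vertexProj y), adjoint_vertexProj] at h
  -- With `r` and `r'` the vacuum expectations of the two resolvents at `x` and `y`, equal traces
  -- say `μ y (1 - r') = μ x (1 - r)`. As `r ≤ 1` and `μ x ≤ μ y`, this gives `r ≤ r'`.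
  have h2 := Tr_resolv_star hμ hT ht
  rw [Tr_eq_of_vac fun z hz => resolv_apply_eq_self _ ht (apply_vac_of_mul_vertexProj hy' hz),
    Tr_eq_of_vac fun z hz => resolv_apply_eq_self _ ht (apply_vac_of_mul_vertexProj hx hz)] at h2
  have h3 := congrArg Complex.re (add_left_cancel h2)
  rw [Complex.re_ofReal_mul, Complex.re_ofReal_mul, Complex.sub_re, Complex.sub_re,
    Complex.one_re] at h3
  have h4 : (inner ℂ (vac x) (resolv T t (vac x))).re ≤ 1 := by
    refine (Complex.re_le_norm _).trans ((norm_inner_le_norm (𝕜 := ℂ) _ _).trans ?_)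
    have h5 := norm_resolv_le T ht (vac x)
    rw [norm_vac] at h5 ⊢
    linarith
  have := hμ y
  by_contra! h6
  nlinarith

end Dimension

/-! ### Polynomials as combinations of path operators -/

section Polynomials

variable (μ : V(G) → ℝ)

/-- The product of the operators `X_ε` along a path. -/
def wordOp (p : DPath G) : FockSpace G →L[ℂ] FockSpace G :=
  vertexProj p.start * (p.edges.map (arcOp μ)).prod

theorem wordOp_nil (x : V(G)) : wordOp μ (DPath.nil x) = vertexProj x := by
  simp [wordOp, DPath.nil]

theorem wordOp_cons (ε : DEdge G) (p : DPath G) (h : ε.tgt = p.start) :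
    wordOp μ (DPath.cons ε p h) = arcOp μ ε * wordOp μ p := by
  rw [wordOp, wordOp, ← mul_assoc, arcOp_mul_vertexProj, if_pos h]
  simp only [DPath.cons, List.map_cons, List.prod_cons]
  rw [← mul_assoc, vertexProj_mul_arcOp, if_pos rfl]

theorem wordOp_mul_vertexProj (p : DPath G) (x : V(G)) :
    wordOp μ p * vertexProj x = if p.finish = x then wordOp μ p else 0 := by
  induction p using DPath.induction_cons with
  | nil y =>
    rw [wordOp_nil, vertexProj_mul_vertexProj]; rfl
  | cons ε p h ih =>
    rw [wordOp_cons, mul_assoc, ih, DPath.finish_cons, mul_ite, mul_zero]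

theorem vertexProj_mul_wordOp (p : DPath G) (x : V(G)) :
    vertexProj x * wordOp μ p = if p.start = x then wordOp μ p else 0 := by
  rw [wordOp, ← mul_assoc, vertexProj_mul_vertexProj]
  by_cases h : x = p.start
  · simp [h]
  · simp [h, Ne.symm h]

theorem wordOp_mem (p : DPath G) : wordOp μ p ∈ polyAlgebra G μ := by
  refine mul_mem (Algebra.subset_adjoin (Or.inl ⟨_, rfl⟩)) (list_prod_mem fun A hA => ?_)
  obtain ⟨ε, -, rfl⟩ := List.mem_map.1 hA
  exact Algebra.subset_adjoin (Or.inr ⟨_, rfl⟩)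

/-- The polynomial with the given coefficients. -/
def polyOf (F : DPath G →₀ ℂ) : FockSpace G →L[ℂ] FockSpace G :=
  Finsupp.linearCombination ℂ (wordOp μ) F

theorem polyOf_eq_sum (F : DPath G →₀ ℂ) : polyOf μ F = ∑ w ∈ F.support, F w • wordOp μ w := rfl

theorem polyOf_add (F F' : DPath G →₀ ℂ) : polyOf μ (F + F') = polyOf μ F + polyOf μ F' :=
  map_add _ _ _

theorem polyOf_single (w : DPath G) (c : ℂ) : polyOf μ (Finsupp.single w c) = c • wordOp μ w :=
  Finsupp.linearCombination_single _ _ _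

theorem polyOf_mem (F : DPath G →₀ ℂ) : polyOf μ F ∈ polyAlgebra G μ :=
  sum_mem fun w _ => Subalgebra.smul_mem _ (wordOp_mem μ w) _

/-- The span of the path operators is stable under left multiplication by polynomials, and it
contains `1` as the finite sum of the vertex projections. -/
theorem exists_eq_polyOf [Fintype V(G)] {Q : FockSpace G →L[ℂ] FockSpace G}
    (hQ : Q ∈ polyAlgebra G μ) : ∃ F, Q = polyOf μ F := by
  have key : ∀ S ∈ Submodule.span ℂ (Set.range (wordOp (G := G) μ)),
      Q * S ∈ Submodule.span ℂ (Set.range (wordOp (G := G) μ)) := by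
    induction hQ using Algebra.adjoin_induction with
    | mem T h =>
      intro S hS
      induction hS using Submodule.span_induction with
      | mem S hS =>
        obtain ⟨w, rfl⟩ := hS
        rcases h with ⟨x, rfl⟩ | ⟨ε, rfl⟩
        · rw [vertexProj_mul_wordOp]
          split_ifs
          exacts [Submodule.subset_span ⟨w, rfl⟩, zero_mem _]
        · by_cases h : ε.tgt = w.start
          · rw [← wordOp_cons μ ε w h]
            exact Submodule.subset_span ⟨_, rfl⟩
          · rw [wordOp, ← mul_assoc, arcOp_mul_vertexProj, if_neg h, zero_mul]
            exact zero_mem _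
      | zero => rw [mul_zero]; exact zero_mem _
      | add A B _ _ hA hB => rw [mul_add]; exact add_mem hA hB
      | smul c A _ hA => rw [mul_smul_comm]; exact Submodule.smul_mem _ _ hA
    | algebraMap c =>
      intro S hS
      rw [Algebra.algebraMap_eq_smul_one, smul_mul_assoc, one_mul]
      exact Submodule.smul_mem _ _ hS
    | add A B _ _ hA hB => intro S hS; rw [add_mul]; exact add_mem (hA S hS) (hB S hS)
    | mul A B _ _ hA hB => intro S hS; rw [mul_assoc]; exact hA _ (hB S hS)
  have h1 : Q ∈ Submodule.span ℂ (Set.range (wordOp (G := G) μ)) := by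
    rw [← mul_one Q, ← sum_vertexProj]
    refine key _ (sum_mem fun x _ => Submodule.subset_span ⟨DPath.nil x, wordOp_nil μ x⟩)
  obtain ⟨F, hF⟩ := (Finsupp.mem_span_range_iff_exists_finsupp).1 h1
  exact ⟨F, hF.symm⟩

theorem vertexProj_mul_polyOf (x : V(G)) (F : DPath G →₀ ℂ) :
    vertexProj x * polyOf μ F = polyOf μ (F.filter fun w => w.start = x) := by
  induction F using Finsupp.induction_linear with
  | zero => rw [Finsupp.filter_zero]; simp [polyOf]
  | add F F' h h' => rw [polyOf_add, mul_add, h, h', Finsupp.filter_add, polyOf_add]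
  | single w c =>
    rw [polyOf_single, mul_smul_comm, vertexProj_mul_wordOp]
    by_cases h : w.start = x
    · rw [if_pos h, Finsupp.filter_single_of_pos (fun w : DPath G => w.start = x) h, polyOf_single]
    · rw [if_neg h, Finsupp.filter_single_of_neg (fun w : DPath G => w.start = x) h, smul_zero]
      simp [polyOf]

theorem polyOf_mul_vertexProj (x : V(G)) (F : DPath G →₀ ℂ) :
    polyOf μ F * vertexProj x = polyOf μ (F.filter fun w => w.finish = x) := by
  induction F using Finsupp.induction_linear with
  | zero => rw [Finsupp.filter_zero]; simp [polyOf]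
  | add F F' h h' => rw [polyOf_add, add_mul, h, h', Finsupp.filter_add, polyOf_add]
  | single w c =>
    rw [polyOf_single, smul_mul_assoc, wordOp_mul_vertexProj]
    by_cases h : w.finish = x
    · rw [if_pos h, Finsupp.filter_single_of_pos (fun w : DPath G => w.finish = x) h, polyOf_single]
    · rw [if_neg h, Finsupp.filter_single_of_neg (fun w : DPath G => w.finish = x) h, smul_zero]
      simp [polyOf]

/-- The commutator of a path operator with a right annihilation operator, contracted on the left
with a vector. -/
theorem exists_contracted_commutator (ε : DEdge G) (w : DPath G) : ∀ ξ : FockSpace G,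
    ∃ F : DPath G →₀ ℂ,
      (∀ v, F v ≠ 0 → v.length < w.length ∧ v.start = ε.tgt ∧ v.finish = w.finish) ∧
      (∀ v, v.length + 1 = w.length → F v =
        if ∃ h, w = DPath.cons ε v h then -(weightRatio μ ε : ℂ) * inner ℂ ξ (vac ε.src) else 0) ∧
      ∀ η, inner ℂ ξ ((wordOp μ w * adjoint (rightCreation ε)
        - adjoint (rightCreation ε) * wordOp μ w) η) = inner ℂ (vac ε.tgt) (polyOf μ F η) := by
  induction w using DPath.induction_cons with
  | nil x =>
    intro ξ
    refine ⟨0, fun v hv => absurd rfl hv, fun v hv => by simp at hv, fun η => ?_⟩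
    rw [wordOp_nil, vertexProj_mul_rightAnnihilation, sub_self]
    simp [polyOf]
  | cons δ w h ih =>
    intro ξ
    -- Leibniz rule: in the first term `X_δ` moves to the other side of the inner product, hence the
    -- induction over all `ξ`. The second term has rank one and contributes `c` times the path `w`
    -- exactly when `δ = ε`.
    obtain ⟨F, hF1, -, hF3⟩ := ih (adjoint (arcOp μ δ) ξ)
    set c : ℂ := -(weightRatio μ ε : ℂ) * inner ℂ ξ (vac ε.src) with hc
    refine ⟨F + if δ = ε then Finsupp.single w c else 0, fun v hv => ?_, fun v hv => ?_,
      fun η => ?_⟩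
    · rw [DPath.length_cons, DPath.finish_cons]
      by_cases h0 : F v = 0
      · rw [Finsupp.add_apply, h0, zero_add] at hv
        split_ifs at hv with h1
        · by_cases h2 : w = v
          · subst h2; subst h1
            exact ⟨Nat.lt_succ_self _, h.symm, rfl⟩
          · rw [Finsupp.single_eq_of_ne (Ne.symm h2)] at hv
            exact absurd rfl hv
        · exact absurd rfl hv
      · obtain ⟨h1, h2, h3⟩ := hF1 v h0
        exact ⟨h1.trans (Nat.lt_succ_self _), h2, h3⟩
    · rw [DPath.length_cons, Nat.add_right_cancel_iff] at hv
      have h0 : F v = 0 := by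
        by_contra h0
        exact absurd (hF1 v h0).1 (by rw [hv]; exact lt_irrefl _)
      rw [Finsupp.add_apply, h0, zero_add]
      by_cases h1 : δ = ε
      · subst h1
        rw [if_pos rfl, Finsupp.single_apply]
        refine if_congr ⟨fun e => ⟨e ▸ h, by subst e; rfl⟩, fun ⟨h', e⟩ =>
          (DPath.cons_inj.1 e).2⟩ rfl rfl
      · rw [if_neg h1, if_neg]
        · rfl
        · rintro ⟨h', e⟩
          exact h1 (DPath.cons_inj.1 e).1
    · have e1 : wordOp μ (DPath.cons δ w h) * adjoint (rightCreation ε)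
          - adjoint (rightCreation ε) * wordOp μ (DPath.cons δ w h) =
          arcOp μ δ * (wordOp μ w * adjoint (rightCreation ε)
            - adjoint (rightCreation ε) * wordOp μ w) - (if δ = ε then
          (weightRatio μ ε : ℂ) • InnerProductSpace.rankOne ℂ (vac ε.src) (vac ε.tgt) else 0)
            * wordOp μ w := by
        have e2 := arcOp_mul_rightAnnihilation μ δ ε
        rw [eq_sub_iff_add_eq, ← eq_sub_iff_add_eq'] at e2
        rw [wordOp_cons, e2]
        simp only [mul_sub, sub_mul, mul_assoc]
        abel
      rw [e1, sub_apply, inner_sub_right, mul_apply_eq_comp (arcOp μ δ),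
        ← ContinuousLinearMap.adjoint_inner_left, hF3, polyOf_add, add_apply, inner_add_right,
        sub_eq_add_neg]
      congr 1
      by_cases h1 : δ = ε
      · rw [if_pos h1, if_pos h1, polyOf_single, mul_apply_eq_comp, smul_apply, smul_apply,
          InnerProductSpace.rankOne_apply, inner_smul_right, inner_smul_right, inner_smul_right,
          hc]
        ring
      · rw [if_neg h1, if_neg h1]
        simp [polyOf]

variable {μ}

theorem polyOf_mul_vertexProj_eq_self {F : DPath G →₀ ℂ} {x : V(G)}
    (h : ∀ w, F w ≠ 0 → w.finish = x) : polyOf μ F * vertexProj x = polyOf μ F := by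
  rw [polyOf_mul_vertexProj, Finsupp.filter_eq_self_iff _ _ |>.2 h]

theorem vertexProj_mul_polyOf_eq_self {F : DPath G →₀ ℂ} {x : V(G)}
    (h : ∀ w, F w ≠ 0 → w.start = x) : vertexProj x * polyOf μ F = polyOf μ F := by
  rw [vertexProj_mul_polyOf, Finsupp.filter_eq_self_iff _ _ |>.2 h]

/-- The range condition makes `star B` vanish on every other vacuum vector, so one vector suffices
for separation. -/
theorem eq_zero_of_star_vac (hμ : ∀ x, 0 < μ x) {B : FockSpace G →L[ℂ] FockSpace G}
    (hB : B ∈ rightCommutant μ) {x : V(G)} (hx : vertexProj x * B = B)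
    (h : star B (vac x) = 0) : B = 0 := by
  refine star_eq_zero.1 (eq_zero_of_vac hμ (star_mem hB) fun y => ?_)
  by_cases hy : y = x
  · rw [hy, h]
  · refine apply_vac_of_mul_vertexProj ?_ hy
    have h1 := congrArg star hx
    rwa [star_mul, ContinuousLinearMap.star_eq_adjoint (vertexProj x), adjoint_vertexProj] at h1

/-- The degree descent. Nonvanishing is asked of a top coefficient and not of the operator, so
linear independence of the path operators is not needed. -/
theorem eq_zero_of_polyOf_mul_eq_zero [Fintype V(G)] (hμ : ∀ x, 0 < μ x) {α : V(G)}
    (hα : ∀ β, μ α ≤ μ β) {a : FockSpace G →L[ℂ] FockSpace G} (ha : a ∈ rightCommutant μ)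
    (haα : vertexProj α * a = a) (d : ℕ) : ∀ (F : DPath G →₀ ℂ) (w₀ : DPath G),
    F w₀ ≠ 0 → w₀.length = d →
    (∀ w, F w ≠ 0 → w.start = w₀.start ∧ w.finish = α ∧ w.length ≤ d) →
    polyOf μ F * a = 0 → a = 0 := by
  induction d with
  | zero =>
    intro F w₀ hw₀ _ hF h0
    have h1 : ∀ w, F w ≠ 0 → w = DPath.nil α := by
      intro w hw
      obtain ⟨-, h2, h3⟩ := hF w hw
      induction w using DPath.induction_cons with
      | nil x => rw [← h2]; rfl
      | cons => simp at h3
    have h2 : F = Finsupp.single (DPath.nil α) (F (DPath.nil α)) := by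
      refine Finsupp.support_subset_singleton.1 fun w hw => ?_
      exact Finset.mem_singleton.2 (h1 w (Finsupp.mem_support_iff.1 hw))
    rw [h2, polyOf_single, wordOp_nil, smul_mul_assoc, haα] at h0
    exact (smul_eq_zero.1 h0).resolve_left (h1 w₀ hw₀ ▸ hw₀)
  | succ d ih =>
    intro F w₀ hw₀ hd hF h0
    induction w₀ using DPath.induction_cons with
    | nil => simp at hd
    | cons ε w₁ h _ =>
      by_contra hane
      rw [DPath.length_cons, Nat.add_right_cancel_iff] at hd
      set T := polyOf μ F with hT
      have hT1 : T * vertexProj α = T := polyOf_mul_vertexProj_eq_self fun w hw => (hF w hw).2.1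
      have hT2 : vertexProj ε.src * T = T :=
        vertexProj_mul_polyOf_eq_self fun w hw => (hF w hw).1
      -- The kernel vector `a a* vac α` is not orthogonal to `vac α`: their inner product is `‖a*
      -- vac α‖²`.
      have h1 : T (a (star a (vac α))) = 0 := DFunLike.congr_fun h0 (star a (vac α))
      have h2 : inner ℂ (a (star a (vac α))) (vac α) ≠ 0 := by
        rw [← ContinuousLinearMap.adjoint_inner_right, ← ContinuousLinearMap.star_eq_adjoint]
        exact inner_self_ne_zero.2 fun h3 => hane (eq_zero_of_star_vac hμ ha haα h3)
      have h3 := kerProj_star_vac_ne_zero hμ (polyOf_mem μ F) (hα ε.src) hT1 hT2 h1 h2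
      have h4 := inner_kerProj_ne_zero _ h3
      set P := kerProj (star T) with hP
      set ξ := P (vac ε.src) with hξ
      choose D hD1 hD2 hD3 using fun w => exists_contracted_commutator μ ε w ξ
      set F' : DPath G →₀ ℂ := ∑ w ∈ F.support, F w • D w with hF'
      have hF'1 : ∀ v, F' v = ∑ w ∈ F.support, F w * D w v := by
        intro v
        simp [hF', Finsupp.finsetSum_apply]
      have h5 : ∀ v, F' v ≠ 0 → v.start = w₁.start ∧ v.finish = α ∧ v.length ≤ d := by
        intro v hv
        rw [hF'1] at hv
        obtain ⟨w, hw, hwv⟩ := Finset.exists_ne_zero_of_sum_ne_zero hv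
        have h6 := hF w (Finsupp.mem_support_iff.1 hw)
        have h7 := hD1 w v (right_ne_zero_of_mul hwv)
        exact ⟨h7.2.1.trans h, h7.2.2.trans h6.2.1,
          Nat.lt_succ_iff.1 (h7.1.trans_le h6.2.2)⟩
      -- Among words of length `d + 1` only `ε w₁` reduces to `w₁`, and shorter words produce only
      -- paths of length below `d`.
      have h6 : F' w₁ = F (DPath.cons ε w₁ h) *
          (-(weightRatio μ ε : ℂ) * inner ℂ ξ (vac ε.src)) := by
        rw [hF'1, Finset.sum_eq_single (DPath.cons ε w₁ h)]
        · rw [hD2 _ _ (DPath.length_cons ε w₁ h).symm, if_pos ⟨h, rfl⟩]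
        · intro w hw hne
          refine mul_eq_zero_of_right _ ?_
          by_cases h7 : w.length = d + 1
          · rw [hD2 w w₁ (by rw [h7, hd]), if_neg]
            rintro ⟨h', e⟩
            exact hne e
          · by_contra h8
            have h9 := (hD1 w w₁ h8).1
            have h10 := (hF w (Finsupp.mem_support_iff.1 hw)).2.2
            omega
        · intro h7
          rw [Finsupp.notMem_support_iff.1 h7, zero_mul]
      have h7 : F' w₁ ≠ 0 := by
        rw [h6]
        have : (weightRatio μ ε : ℂ) ≠ 0 := by exact_mod_cast (weightRatio_pos hμ ε).ne'
        exact mul_ne_zero hw₀ (mul_ne_zero (neg_ne_zero.2 this) h4)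
      have h8 : ∀ η, inner ℂ (vac ε.tgt) (polyOf μ F' η) = inner ℂ ξ
          ((T * adjoint (rightCreation ε) - adjoint (rightCreation ε) * T) η) := by
        intro η
        have e1 : polyOf μ F' = ∑ w ∈ F.support, F w • polyOf μ (D w) := by
          simp only [polyOf, hF', map_sum, map_smul]
        have e2 : T * adjoint (rightCreation ε) - adjoint (rightCreation ε) * T =
            ∑ w ∈ F.support, F w • (wordOp μ w * adjoint (rightCreation ε)
              - adjoint (rightCreation ε) * wordOp μ w) := by
          rw [hT, polyOf_eq_sum, Finset.sum_mul, Finset.mul_sum, ← Finset.sum_sub_distrib]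
          simp only [smul_mul_assoc, mul_smul_comm, smul_sub]
        rw [e1, e2, sum_apply, sum_apply, inner_sum, inner_sum]
        refine Finset.sum_congr rfl fun w _ => ?_
        rw [smul_apply, smul_apply, inner_smul_right, inner_smul_right, hD3]
      have h9 : P * T = 0 := by
        have := kerProj_mul_star (star T)
        rwa [star_star] at this
      -- Both halves of the commutator vanish: one by `T * a = 0`, the other by `P * T = 0`.
      have h10 : ∀ η, inner ℂ (vac ε.tgt) ((polyOf μ F' * a) η) = 0 := by
        intro η
        have e1 : T (a η) = 0 := DFunLike.congr_fun h0 η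
        rw [mul_apply_eq_comp, h8, sub_apply, mul_apply_eq_comp, mul_apply_eq_comp, e1, map_zero,
          sub_zero, hξ, ← ContinuousLinearMap.adjoint_inner_right,
          ← ContinuousLinearMap.star_eq_adjoint, hP, star_kerProj, ← hP, ← mul_apply_eq_comp, h9,
          zero_apply, inner_zero_right]
      have h11 : polyOf μ F' * a = 0 := by
        refine eq_zero_of_star_vac (x := ε.tgt) hμ
          (mul_mem (polyAlgebra_le_rightCommutant hμ (polyOf_mem μ F')) ha) ?_ ?_
        · rw [← mul_assoc, vertexProj_mul_polyOf_eq_self fun w hw => (h5 w hw).1.trans h.symm]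
        · refine ext_inner_right ℂ fun η => ?_
          rw [ContinuousLinearMap.star_eq_adjoint, ContinuousLinearMap.adjoint_inner_left, h10,
            inner_zero_left]
      exact hane (ih F' w₁ h7 hd h5 h11)

/-- A nonzero polynomial in the corner at a vertex of least weight has no zero divisors in the
commutant of the right operators. -/
theorem eq_zero_of_polynomial_mul_eq_zero [Fintype V(G)] (hμ : ∀ x, 0 < μ x) {α : V(G)}
    (hα : ∀ β, μ α ≤ μ β) {Q : FockSpace G →L[ℂ] FockSpace G} (hQ : Q ∈ polyAlgebra G μ)
    (hQ0 : Q ≠ 0) (hQα : Q * vertexProj α = Q) {a : FockSpace G →L[ℂ] FockSpace G}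
    (ha : a ∈ rightCommutant μ) (haα : vertexProj α * a = a) (h0 : Q * a = 0) : a = 0 := by
  obtain ⟨F₀, rfl⟩ := exists_eq_polyOf μ hQ
  rw [polyOf_mul_vertexProj] at hQα
  set F := F₀.filter fun w => w.finish = α with hF
  have hne : F.support.Nonempty := by
    rw [Finsupp.support_nonempty_iff]
    intro h
    rw [h] at hQα
    exact hQ0 (by rw [← hQα]; simp [polyOf])
  obtain ⟨w₀, hw₀, hmax⟩ := F.support.exists_max_image DPath.length hne
  have hfinish : ∀ w, F w ≠ 0 → w.finish = α := fun w hw => by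
    by_contra h
    exact hw (Finsupp.filter_apply_neg (fun w : DPath G => w.finish = α) _ h)
  -- Left multiplication by the projection at the start of a longest word keeps that word and leaves
  -- a polynomial with a single starting vertex.
  refine eq_zero_of_polyOf_mul_eq_zero hμ hα ha haα w₀.length
    (F.filter fun w => w.start = w₀.start) w₀ ?_ rfl ?_ ?_
  · rw [Finsupp.filter_apply_pos (fun w : DPath G => w.start = w₀.start) _ rfl]
    exact Finsupp.mem_support_iff.1 hw₀
  · intro w hw
    have h1 : w.start = w₀.start := by
      by_contra h
      exact hw (Finsupp.filter_apply_neg (fun w : DPath G => w.start = w₀.start) _ h)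
    rw [Finsupp.filter_apply_pos (fun w : DPath G => w.start = w₀.start) _ h1] at hw
    exact ⟨h1, hfinish w hw, hmax w (Finsupp.mem_support_iff.2 hw)⟩
  · rw [← vertexProj_mul_polyOf, hQα, mul_assoc, h0, mul_zero]

end Polynomials

/-! ### Spectral measures -/

section Spectral

open MeasureTheory Polynomial CompactlySupported

variable {H : Type*} [NormedAddCommGroup H] [InnerProductSpace ℂ H]

/-- The finite compactly supported measure `ν` has the moments of the vector state of `ξ` at `Q`. -/
structure IsSpectralMeasure (Q : H →L[ℂ] H) (ξ : H) (ν : Measure ℝ) : Prop where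
  finite : IsFiniteMeasure ν
  support : ∃ R : ℝ, ν (Set.Icc (-R) R)ᶜ = 0
  moments : ∀ n : ℕ, ∫ x, x ^ n ∂ν = (inner ℂ ξ ((Q ^ n) ξ)).re

theorem integrable_of_continuous {ν : Measure ℝ} [IsFiniteMeasure ν] {R : ℝ}
    (hR : ν (Set.Icc (-R) R)ᶜ = 0) {f : ℝ → ℝ} (hf : Continuous f) : Integrable f ν := by
  rw [← Measure.restrict_eq_self_of_ae_mem (s := Set.Icc (-R) R) (μ := ν) (by rwa [ae_iff])]
  exact hf.continuousOn.integrableOn_compact isCompact_Icc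

theorem IsSpectralMeasure.integral_polynomial {Q : H →L[ℂ] H} {ξ : H} {ν : Measure ℝ}
    (h : IsSpectralMeasure Q ξ ν) (p : ℝ[X]) :
    ∫ x, p.eval x ∂ν = (inner ℂ ξ ((aeval Q p) ξ)).re := by
  have := h.finite
  obtain ⟨R, hR⟩ := h.support
  induction p using Polynomial.induction_on' with
  | add p q hp hq =>
    simp only [eval_add, map_add, add_apply, inner_add_right, Complex.add_re]
    rw [integral_add (integrable_of_continuous hR p.continuous)
      (integrable_of_continuous hR q.continuous), hp, hq]
  | monomial n c =>
    simp only [eval_monomial, aeval_monomial]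
    rw [integral_const_mul, h.moments, ← Algebra.smul_def, smul_apply,
      RCLike.real_smul_eq_coe_smul (K := ℂ), inner_smul_right]
    exact (Complex.re_ofReal_mul _ _).symm

variable [CompleteSpace H]

/-- Riesz–Markov for the positive functional `f ↦ ⟨ξ, f(Q) ξ⟩` on the compact real spectrum, pushed
forward to the line. -/
theorem exists_isSpectralMeasure {Q : H →L[ℂ] H} (hQ : IsSelfAdjoint Q) (ξ : H) :
    ∃ ν, IsSpectralMeasure Q ξ ν := by
  let X := spectrum ℝ Q
  let L : C_c(X, ℝ) →ₗ[ℝ] ℝ :=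
    { toFun := fun f => (inner ℂ ξ (cfcHom hQ f.toContinuousMap ξ)).re
      map_add' := fun f g => by
        have : (f + g).toContinuousMap = f.toContinuousMap + g.toContinuousMap := rfl
        rw [this, map_add, add_apply, inner_add_right, Complex.add_re]
      map_smul' := fun c f => by
        have : (c • f).toContinuousMap = c • f.toContinuousMap := rfl
        rw [this, map_smul, smul_apply, RCLike.real_smul_eq_coe_smul (K := ℂ), inner_smul_right]
        exact Complex.re_ofReal_mul _ _ }
  have hL : ∀ f, 0 ≤ f → 0 ≤ L f := by
    intro f hf
    have h1 : 0 ≤ cfcHom hQ f.toContinuousMap := (cfcHom_nonneg_iff hQ).2 hf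
    exact ((ContinuousLinearMap.nonneg_iff_isPositive _).1 h1).re_inner_nonneg_right ξ
  let Λ := PositiveLinearMap.mk₀ L hL
  let ρ := RealRMK.rieszMeasure Λ
  have hρ : IsFiniteMeasure ρ := ⟨isCompact_univ.measure_lt_top⟩
  have hval : Measurable (Subtype.val : X → ℝ) := measurable_subtype_coe
  refine ⟨ρ.map Subtype.val, inferInstance, ?_, fun n => ?_⟩
  · obtain ⟨R, hR⟩ := (spectrum.isCompact (𝕜 := ℝ) Q).isBounded.subset_closedBall 0
    refine ⟨R, ?_⟩
    rw [Measure.map_apply hval measurableSet_Icc.compl]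
    convert measure_empty (μ := ρ)
    rw [Set.eq_empty_iff_forall_notMem]
    rintro ⟨x, hx⟩ h
    have := hR hx
    rw [Real.closedBall_eq_Icc, zero_sub, zero_add] at this
    exact h this
  · rw [integral_map hval.aemeasurable (by fun_prop)]
    let f : C(X, ℝ) := (ContinuousMap.restrict X (ContinuousMap.id ℝ)) ^ n
    have h1 := RealRMK.integral_rieszMeasure Λ
      (CompactlySupportedContinuousMap.continuousMapEquiv f)
    have h2 : cfcHom hQ f = Q ^ n := by
      rw [map_pow, cfcHom_id hQ]
    calc ∫ x : X, (x : ℝ) ^ n ∂ρ = Λ (CompactlySupportedContinuousMap.continuousMapEquiv f) := h1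
      _ = (inner ℂ ξ (cfcHom hQ f ξ)).re := rfl
      _ = _ := by rw [h2]

/-- Weierstrass approximation extends the moment identity to continuous functions; uniqueness of the
measure follows at once. -/
theorem IsSpectralMeasure.integral_eq {Q : H →L[ℂ] H} (hQ : IsSelfAdjoint Q) {ξ : H}
    {ν : Measure ℝ} (h : IsSpectralMeasure Q ξ ν) {f : ℝ → ℝ} (hf : Continuous f) :
    ∫ x, f x ∂ν = (inner ℂ ξ (cfc f Q ξ)).re := by
  have := h.finite
  obtain ⟨R, hR⟩ := h.support
  obtain ⟨R', hR'⟩ := (spectrum.isCompact (𝕜 := ℝ) Q).isBounded.subset_closedBall 0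
  rw [Real.closedBall_eq_Icc, zero_sub, zero_add] at hR'
  -- The support of `ν` is not known to lie in the spectrum, so the approximation is made on an
  -- interval that contains both.
  set M := max R R'
  have key : ∀ ε > 0, |∫ x, f x ∂ν - (inner ℂ ξ (cfc f Q ξ)).re| ≤
      ε * (ν.real Set.univ + ‖ξ‖ ^ 2) := by
    intro ε hε
    obtain ⟨p, hp⟩ := exists_polynomial_near_of_continuousOn (-M) M f hf.continuousOn ε hε
    have h1 : |∫ x, f x ∂ν - ∫ x, p.eval x ∂ν| ≤ ε * ν.real Set.univ := by
      rw [← integral_sub (integrable_of_continuous hR hf)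
        (integrable_of_continuous hR p.continuous), ← Real.norm_eq_abs]
      refine norm_integral_le_of_norm_le_const ?_
      have hae : ∀ᵐ x ∂ν, x ∈ Set.Icc (-R) R := by rwa [ae_iff]
      filter_upwards [hae] with x hx
      rw [Real.norm_eq_abs, abs_sub_comm]
      exact (hp x ⟨(neg_le_neg (le_max_left _ _)).trans hx.1, hx.2.trans (le_max_left _ _)⟩).le
    have h2 : |(inner ℂ ξ (cfc p.eval Q ξ)).re - (inner ℂ ξ (cfc f Q ξ)).re| ≤
        ε * ‖ξ‖ ^ 2 := by
      rw [← Complex.sub_re, ← inner_sub_right, ← sub_apply,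
        ← cfc_sub p.eval f Q p.continuous.continuousOn hf.continuousOn]
      have h3 : ‖cfc (fun x => p.eval x - f x) Q‖ ≤ ε := by
        refine norm_cfc_le hε.le fun x hx => ?_
        have hx' := hR' hx
        exact (hp x ⟨(neg_le_neg (le_max_right _ _)).trans hx'.1,
          hx'.2.trans (le_max_right _ _)⟩).le
      calc _ ≤ ‖inner ℂ ξ (cfc (fun x => p.eval x - f x) Q ξ)‖ := Complex.abs_re_le_norm _
        _ ≤ ‖ξ‖ * (‖cfc (fun x => p.eval x - f x) Q‖ * ‖ξ‖) :=
          (norm_inner_le_norm _ _).trans (by gcongr; exact ContinuousLinearMap.le_opNorm _ _)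
        _ ≤ ‖ξ‖ * (ε * ‖ξ‖) := by gcongr
        _ = ε * ‖ξ‖ ^ 2 := by ring
    rw [cfc_polynomial p Q hQ, ← h.integral_polynomial p] at h2
    calc _ ≤ _ := abs_sub_le _ (∫ x, p.eval x ∂ν) _
      _ ≤ _ := by rw [mul_add]; exact add_le_add h1 h2
  rw [← sub_eq_zero, ← abs_nonpos_iff]
  refine le_of_forall_pos_le_add fun δ hδ => ?_
  have hC : 0 < ν.real Set.univ + ‖ξ‖ ^ 2 + 1 := by positivity
  refine (key (δ / (ν.real Set.univ + ‖ξ‖ ^ 2 + 1)) (by positivity)).trans ?_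
  rw [zero_add, div_mul_eq_mul_div, div_le_iff₀ hC]
  nlinarith

theorem IsSpectralMeasure.unique {Q : H →L[ℂ] H} (hQ : IsSelfAdjoint Q) {ξ : H}
    {ν ν' : Measure ℝ} (h : IsSpectralMeasure Q ξ ν) (h' : IsSpectralMeasure Q ξ ν') : ν = ν' := by
  have := h.finite
  have := h'.finite
  refine ext_of_forall_integral_eq_of_IsFiniteMeasure fun f => ?_
  rw [h.integral_eq hQ f.continuous, h'.integral_eq hQ f.continuous]

theorem cfc_eq_resolv {Q : H →L[ℂ] H} (hQ : IsSelfAdjoint Q) (x : ℝ) {t : ℝ} (ht : 0 ≤ t) :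
    cfc (fun y => (1 + t * (y - x) ^ 2)⁻¹) Q = resolv (Q - (x : ℂ) • 1) t := by
  have hpos : ∀ y, 0 < 1 + t * (y - x) ^ 2 := fun y => by positivity
  have h1 : cfc (fun y => 1 + t * (y - x) ^ 2) Q =
      1 + (t : ℂ) • (star (Q - (x : ℂ) • 1) * (Q - (x : ℂ) • 1)) := by
    have e : (fun y => 1 + t * (y - x) ^ 2) = (1 + C t * (X - C x) ^ 2 : ℝ[X]).eval := by
      ext y; simp
    have e2 : ∀ c : ℝ, algebraMap ℝ (H →L[ℂ] H) c = (c : ℂ) • 1 := fun c => by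
      rw [Algebra.algebraMap_eq_smul_one, RCLike.real_smul_eq_coe_smul (K := ℂ)]; rfl
    rw [e, cfc_polynomial _ Q hQ]
    simp only [map_add, map_mul, map_pow, map_sub, map_one, aeval_X, aeval_C, e2, star_sub,
      star_smul, star_one, hQ.star_eq, smul_mul_assoc, one_mul]
    simp [sq]
  have h2 : (1 + (t : ℂ) • (star (Q - (x : ℂ) • 1) * (Q - (x : ℂ) • 1))) *
      cfc (fun y => (1 + t * (y - x) ^ 2)⁻¹) Q = 1 := by
    have hc : Continuous fun y => (1 + t * (y - x) ^ 2)⁻¹ :=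
      Continuous.inv₀ (by fun_prop) fun y => (hpos y).ne'
    rw [← h1, ← cfc_mul (fun y => 1 + t * (y - x) ^ 2) (fun y => (1 + t * (y - x) ^ 2)⁻¹) Q
      (by fun_prop) hc.continuousOn]
    simp only [fun y => mul_inv_cancel₀ (hpos y).ne']
    exact cfc_const_one ℝ Q
  calc _ = resolv (Q - (x : ℂ) • 1) t *
        (1 + (t : ℂ) • (star (Q - (x : ℂ) • 1) * (Q - (x : ℂ) • 1))) * _ := by
        rw [resolv_mul _ ht, one_mul]
    _ = _ := by rw [mul_assoc, h2, mul_one]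

/-- An atom of the spectral measure gives an eigenvector. -/
theorem IsSpectralMeasure.kerProj_ne_zero {Q : H →L[ℂ] H} (hQ : IsSelfAdjoint Q) {ξ : H}
    {ν : Measure ℝ} (h : IsSpectralMeasure Q ξ ν) {x : ℝ} (hx : ν {x} ≠ 0) :
    kerProj (Q - (x : ℂ) • 1) ξ ≠ 0 := by
  have := h.finite
  obtain ⟨R, hR⟩ := h.support
  refine kerProj_apply_ne_zero _ (c := ν.real {x})
    (ENNReal.toReal_pos hx (measure_ne_top _ _)) fun t ht => ?_
  have hpos : ∀ y, 0 < 1 + t * (y - x) ^ 2 := fun y => by positivity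
  have hc : Continuous fun y => (1 + t * (y - x) ^ 2)⁻¹ :=
    Continuous.inv₀ (by fun_prop) fun y => (hpos y).ne'
  rw [← cfc_eq_resolv hQ x ht, ← h.integral_eq hQ hc]
  -- For every `t ≥ 0` the function `(1 + t (y - x)²)⁻¹` dominates the indicator of `{x}`, so the
  -- mass of the atom bounds all resolvents from below.
  have h1 : ν.real {x} = ∫ y, Set.indicator {x} (fun _ => (1 : ℝ)) y ∂ν := by
    rw [integral_indicator_const _ (measurableSet_singleton x), smul_eq_mul, mul_one]
  rw [h1]
  refine integral_mono ((integrable_const _).indicator (measurableSet_singleton x))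
    (integrable_of_continuous hR hc) fun y => ?_
  by_cases hy : y = x
  · subst hy; simp
  · rw [Set.indicator_of_notMem (by simpa using hy)]
    exact (inv_pos.2 (hpos y)).le

end Spectral

/-! ### The law of a polynomial and the absence of atoms -/

section Law

variable {μ : V(G) → ℝ}

theorem kerProj_mem_rightCommutant {K : FockSpace G →L[ℂ] FockSpace G}
    (hK : K ∈ rightCommutant μ) : kerProj K ∈ rightCommutant μ := by
  rw [rightCommutant, StarSubalgebra.mem_centralizer_iff] at hK ⊢
  intro Y hY
  obtain ⟨h1, h2⟩ := hK Y hY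
  refine ⟨(kerProj_mul_comm h1.symm h2.symm).symm, (kerProj_mul_comm h2.symm ?_).symm⟩
  rw [star_star, h1]

theorem vertexProj_mul_self (x : V(G)) :
    vertexProj x * vertexProj x = (vertexProj x : FockSpace G →L[ℂ] FockSpace G) := by
  rw [vertexProj_mul_vertexProj, if_pos rfl]

variable [Fintype V(G)]

/-- The factor `p_α` leaves only the term at `α` in the trace. Since `vac α` is a unit vector, the
weight `μ α` enters as a scaling of the vector by its square root. -/
theorem isLaw_iff_isSpectralMeasure {α : V(G)} (hμ : 0 < μ α) {Q : FockSpace G →L[ℂ] FockSpace G}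
    (hQ : IsSelfAdjoint Q) (ν : MeasureTheory.Measure ℝ) :
    IsLaw μ α Q ν ↔ IsSpectralMeasure Q ((Real.sqrt (μ α) : ℂ) • vac α) ν := by
  have h1 : ∀ n : ℕ, Tr μ (vertexProj α * Q ^ n) =
      ((inner ℂ ((Real.sqrt (μ α) : ℂ) • vac α)
        ((Q ^ n) ((Real.sqrt (μ α) : ℂ) • vac α))).re : ℂ) := by
    intro n
    have h2 : ∀ x, (μ x : ℂ) * condExpect (vertexProj α * Q ^ n) x =
        if x = α then (μ α : ℂ) * inner ℂ (vac α) ((Q ^ n) (vac α)) else 0 := by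
      intro x
      rw [condExpect_eq, mul_apply_eq_comp, ← ContinuousLinearMap.adjoint_inner_left,
        adjoint_vertexProj, vertexProj_vac]
      by_cases h : x = α
      · subst h; simp
      · simp [h]
    have h3 : inner ℂ ((Real.sqrt (μ α) : ℂ) • vac α)
        ((Q ^ n) ((Real.sqrt (μ α) : ℂ) • vac α)) =
        (μ α : ℂ) * inner ℂ (vac α) ((Q ^ n) (vac α)) := by
      rw [map_smul, inner_smul_left, inner_smul_right, Complex.conj_ofReal, ← mul_assoc,
        ← Complex.ofReal_mul, Real.mul_self_sqrt hμ.le]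
    have h4 : (starRingEnd ℂ) (inner ℂ (vac α) ((Q ^ n) (vac α))) =
        inner ℂ (vac α) ((Q ^ n) (vac α)) := by
      rw [inner_conj_symm, ← ContinuousLinearMap.adjoint_inner_right,
        ← ContinuousLinearMap.star_eq_adjoint, (hQ.pow n).star_eq]
    rw [h3, Complex.re_ofReal_mul, Complex.ofReal_mul, Complex.conj_eq_iff_re.1 h4]
    simp only [Tr, h2, Finset.sum_ite_eq', Finset.mem_univ, if_true]
  constructor
  · rintro ⟨h2, h3, h4⟩
    exact ⟨h2, h3, fun n => Complex.ofReal_injective ((h4 n).trans (h1 n))⟩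
  · rintro ⟨h2, h3, h4⟩
    exact ⟨h2, h3, fun n => by rw [h4 n, h1 n]⟩

/-- The zero divisor is `kerProj K * p`. It is only known to lie in `rightCommutant μ`, which is why
`eq_zero_of_polynomial_mul_eq_zero` is stated there. -/
theorem law_singleton_eq_zero (hμ : ∀ x, 0 < μ x) {α : V(G)} (hα : ∀ β, μ α ≤ μ β)
    {Q : FockSpace G →L[ℂ] FockSpace G} (hQ : Q ∈ polyAlgebra G μ) (hsa : IsSelfAdjoint Q)
    (hQα : Q * vertexProj α = Q) (hne : ∀ c : ℂ, Q ≠ c • vertexProj α)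
    {ν : MeasureTheory.Measure ℝ} (hν : IsLaw μ α Q ν) (x : ℝ) : ν {x} = 0 := by
  by_contra hx
  have h1 := ((isLaw_iff_isSpectralMeasure (hμ α) hsa ν).1 hν).kerProj_ne_zero hsa hx
  set K : FockSpace G →L[ℂ] FockSpace G := Q - (x : ℂ) • 1 with hK
  set p : FockSpace G →L[ℂ] FockSpace G := vertexProj α with hp
  have hps : star p = p := by rw [ContinuousLinearMap.star_eq_adjoint, hp, adjoint_vertexProj]
  have hpQ : p * Q = Q := by
    have h := congrArg star hQα
    rwa [star_mul, hps, hsa.star_eq] at h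
  have hKp : K * p = p * K := by
    rw [hK, sub_mul, mul_sub, hQα, hpQ, smul_mul_assoc, mul_smul_comm, one_mul, mul_one]
  have hPp : kerProj K * p = p * kerProj K := kerProj_mul_comm hKp (by rw [hps, hKp])
  have hKN : K ∈ rightCommutant μ :=
    sub_mem (polyAlgebra_le_rightCommutant hμ hQ) (SMulMemClass.smul_mem _ (one_mem _))
  have hpp : p * p = p := vertexProj_mul_self α
  have hpA : p ∈ polyAlgebra G μ := Algebra.subset_adjoin (Or.inl ⟨α, rfl⟩)
  have ha : kerProj K * p = 0 := by
    -- `K` itself is not in the corner; `Q - x p = p * K` is, and it is nonzero because `Q` is not a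
    -- multiple of `p`.
    refine eq_zero_of_polynomial_mul_eq_zero hμ hα (Q := Q - (x : ℂ) • p)
      (sub_mem hQ (Subalgebra.smul_mem _ hpA _)) (sub_ne_zero.2 (hne x)) ?_
      (mul_mem (kerProj_mem_rightCommutant hKN) (vertexProj_mem_rightCommutant hμ α)) ?_ ?_
    · rw [← hp, sub_mul, hQα, smul_mul_assoc, hpp]
    · rw [← hp, hPp, ← mul_assoc, hpp]
    · have h2 : Q - (x : ℂ) • p = p * K := by
        rw [hK, mul_sub, hpQ, mul_smul_comm, mul_one]
      rw [h2, mul_assoc, ← mul_assoc K, mul_kerProj, zero_mul, mul_zero]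
  refine h1 ?_
  have h3 := DFunLike.congr_fun ha (vac α)
  rw [mul_apply_eq_comp, hp, vertexProj_vac, if_pos rfl] at h3
  rw [map_smul, h3]
  simp

end Law

end

end FreeGraph

open scoped Graph in
theorem mainTheorem2 {V : Type*} {E : Type*} (G : Graph V E) [Fintype V(G)] [Finite E(G)]
    (μ : V(G) → ℝ) (hμ : ∀ β, 0 < μ β) (α : V(G)) (hα : ∀ β, μ α ≤ μ β) :
    (∀ Q ∈ FreeGraph.polyAlgebra G μ, Q ≠ 0 → Q * FreeGraph.vertexProj α = Q →
      ∀ a ∈ FreeGraph.vonNeumann G μ, IsSelfAdjoint a →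
        a = FreeGraph.vertexProj α * a * FreeGraph.vertexProj α → Q * a = 0 → a = 0) ∧
    (∀ Q ∈ FreeGraph.polyAlgebra G μ, IsSelfAdjoint Q → Q * FreeGraph.vertexProj α = Q →
      (∀ c : ℂ, Q ≠ c • FreeGraph.vertexProj α) →
        (∃! ν : MeasureTheory.Measure ℝ, FreeGraph.IsLaw μ α Q ν) ∧
        ∀ ν : MeasureTheory.Measure ℝ, FreeGraph.IsLaw μ α Q ν → ∀ x : ℝ, ν {x} = 0) := by
  refine ⟨fun Q hQ hQ0 hQα a ha _ haα h0 => ?_, fun Q hQ hsa hQα hne => ⟨?_, fun ν hν x => ?_⟩⟩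
  · refine FreeGraph.eq_zero_of_polynomial_mul_eq_zero hμ hα hQ hQ0 hQα
      (FreeGraph.vonNeumann_subset_rightCommutant hμ ha) ?_ h0
    rw [haα, ← mul_assoc, ← mul_assoc, FreeGraph.vertexProj_mul_self]
  · obtain ⟨ν, hν⟩ := FreeGraph.exists_isSpectralMeasure hsa
      ((Real.sqrt (μ α) : ℂ) • FreeGraph.vac α)
    refine ⟨ν, (FreeGraph.isLaw_iff_isSpectralMeasure (hμ α) hsa ν).2 hν, fun ν' hν' => ?_⟩
    exact ((FreeGraph.isLaw_iff_isSpectralMeasure (hμ α) hsa ν').1 hν').unique hsa hν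
  · exact FreeGraph.law_singleton_eq_zero hμ hα hQ hsa hQα hne hν x
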